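/- Let $d$ be a squarefree (in particular non-zero) integer, and let $E^d$ be the elliptic curve $y^2 = x^3 - 11d^2x + 14d^3$ over $\mathbb{Q}$. Fix an algebraic closure $\overline{\mathbb{Q}}$ of $\mathbb{Q}$, and for $n \ge 1$ let $\mathbb{Q}(E^d[n]) \subset \overline{\mathbb{Q}}$ be the $n$-division field, generated over $\mathbb{Q}$ by the coordinates of all the affine points $P \in E^d(\overline{\mathbb{Q}})$ with $nP = O$. Let $$f_4(x) = x^8 - 4x^6 + 8x^4 - 4x^2 + 1$$ and $$\begin{aligned} f_8(x) ={}& x^{32} + 16x^{31} + 120x^{30} + 560x^{29} + 1848x^{28} + 4784x^{27} + 11000x^{26} + 25344x^{25} + 59844x^{24}\\ &+ 133856x^{23} + 260768x^{22} + 419392x^{21} + 534920x^{20} + 513536x^{19} + 332032x^{18} + 93856x^{17}\\ &- 43548x^{16} - 22112x^{15} + 61056x^{14} + 77728x^{13} + 20768x^{12} - 18304x^{11} + 320x^{10} + 21440x^{9}\\ &+ 8240x^{8} - 8256x^{7} - 1888x^{6} + 3584x^{5} + 800x^{4} - 1216x^{3} + 320x^{2} + 8. \end{aligned}$$ Then: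 1. $\mathbb{Q}(E^d[2]) = \mathbb{Q}(\sqrt{2})$. 2. For every root $\alpha \in \overline{\mathbb{Q}}$ of $f_4$, $[\mathbb{Q}(\alpha):\mathbb{Q}] = 8$ and $\mathbb{Q}(E^d[4]) = \mathbb{Q}(\alpha, \sqrt{d})$. 3. For every root $\beta \in \overline{\mathbb{Q}}$ of $f_8$, $[\mathbb{Q}(\beta):\mathbb{Q}] = 32$ and $\mathbb{Q}(E^d[8]) = \mathbb{Q}(\beta, \sqrt{d})$. In particular, $[\mathbb{Q}(E^d[2]):\mathbb{Q}] = 2$; $[\mathbb{Q}(E^d[4]):\mathbb{Q}] = 8$ if and only if $d \in \{\pm 1, \pm 2\}$; and $[\mathbb{Q}(E^d[8]):\mathbb{Q}] = 32$ if and only if $d \in \{\pm 1, \pm 2\}$. If $d \notin \{\pm 1, \pm 2\}$, then $[\mathbb{Q}(E^d[4]):\mathbb{Q}] = 16$ and $[\mathbb{Q}(E^d[8]):\mathbb{Q}] = 64$. -/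

import Mathlib

open Polynomial

open Classical in
/-- The `n`-division field `F(E[n])` of a Weierstrass curve `E` over `F`: the subfield of an
algebraic closure of `F` generated over `F` by the coordinates of all the affine points `P` of `E`
over that closure with `n • P = 0`. -/
noncomputable def divisionField {F : Type*} [Field F] (E : WeierstrassCurve F) (n : ℕ) :
    IntermediateField F (AlgebraicClosure F) :=
  IntermediateField.adjoin F
    {z | ∃ (x y : AlgebraicClosure F)
      (h : (E.baseChange (AlgebraicClosure F)).toAffine.Nonsingular x y),
      n • WeierstrassCurve.Affine.Point.some x y h = 0 ∧ (z = x ∨ z = y)}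

/-- The curve `y ^ 2 = x ^ 3 - 11 d ^ 2 x + 14 d ^ 3` over `ℚ`. -/
def twistCurve (d : ℤ) : WeierstrassCurve ℚ where
  a₁ := 0
  a₂ := 0
  a₃ := 0
  a₄ := -11 * (d : ℚ) ^ 2
  a₆ := 14 * (d : ℚ) ^ 3

/-- The octic polynomial that defines the `4`-division field for `d = 1`. -/
noncomputable def polyFour : ℚ[X] :=
  X ^ 8 - 4 * X ^ 6 + 8 * X ^ 4 - 4 * X ^ 2 + 1

/-- The polynomial of degree `32` that defines the `8`-division field for `d = 1`. -/
noncomputable def polyEight : ℚ[X] :=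
  X ^ 32 + 16 * X ^ 31 + 120 * X ^ 30 + 560 * X ^ 29 + 1848 * X ^ 28 + 4784 * X ^ 27
    + 11000 * X ^ 26 + 25344 * X ^ 25 + 59844 * X ^ 24 + 133856 * X ^ 23 + 260768 * X ^ 22
    + 419392 * X ^ 21 + 534920 * X ^ 20 + 513536 * X ^ 19 + 332032 * X ^ 18 + 93856 * X ^ 17
    - 43548 * X ^ 16 - 22112 * X ^ 15 + 61056 * X ^ 14 + 77728 * X ^ 13 + 20768 * X ^ 12
    - 18304 * X ^ 11 + 320 * X ^ 10 + 21440 * X ^ 9 + 8240 * X ^ 8 - 8256 * X ^ 7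
    - 1888 * X ^ 6 + 3584 * X ^ 5 + 800 * X ^ 4 - 1216 * X ^ 3 + 320 * X ^ 2 + 8

/-! The points of order two have first coordinates e₁ = 2d, e₂ = d(-1 + 2√2), e₃ = d(-1 - 2√2). To
halve a point (X, Y), choose rᵢ with rᵢ² = X - eᵢ: the halves of (X, ±Y) have first coordinate X +
r₁r₂ + r₁r₃ + r₂r₃ and second coordinate (r₁ + r₂)(r₁ + r₃)(r₂ + r₃). Conversely, the rᵢ are
rational functions of the half and the eᵢ. Hence passing from n-torsion to 2n-torsion means
adjoining the square roots of all X - eᵢ. Carrying this out twice gives ℚ(E[4]) = ℚ(ζ₈, 2^(1/4), √d)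
and ℚ(E[8]) = ℚ(ζ₁₆, 2^(1/8), √d): see `divisionField_four` and `divisionField_eight`.

Without √d these fields have degrees 8 and 32, because each is the top of a tower of quadratic
extensions. By `sqrt_mem_or_mem_mul`, the question whether an element is a square moves down one
floor at a time; in ℚ(i) it ends with the irrationality of √2. The same descent shows that a
rational number which is a square in ℚ(ζ₁₆, 2^(1/8)) is ±1 or ±2 times a rational square. Since √-1
and √2 already lie in ℚ(ζ₈), adjoining √d doubles both degrees or neither.

It remains to identify the polynomials. From a root of f₄ one extracts i and a fourth root of -2, so
it generates the octic field. One root of f₈ is an explicit element of ℚ(ζ₁₆, 2^(1/8)) that no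
automorphism moving ζ₁₆ or 2^(1/8) fixes. This makes f₈ its minimal polynomial, and normality of the
field handles the other roots. -/

/-! ### Square roots and degrees in quadratic extensions. -/

section QuadraticExtension

open IntermediateField

variable {F L : Type*} [Field F] [Field L] [Algebra F L]

/-- Adjoining a square root `r` to `K` gives exactly the elements `a + b * r` with `a, b ∈ K`. -/
theorem mem_sup_adjoin_sqrt {K : IntermediateField F L} {r : L} (hr : r ^ 2 ∈ K) {x : L}
    (hx : x ∈ K ⊔ F⟮r⟯) : ∃ a ∈ K, ∃ b ∈ K, x = a + b * r := by
  let S : IntermediateField F L :=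
    { carrier := {x | ∃ a ∈ K, ∃ b ∈ K, x = a + b * r}
      mul_mem' := by
        rintro _ _ ⟨a, ha, b, hb, rfl⟩ ⟨c, hc, e, he, rfl⟩
        exact ⟨a * c + b * e * r ^ 2,
          add_mem (mul_mem ha hc) (mul_mem (mul_mem hb he) hr), a * e + b * c,
          add_mem (mul_mem ha he) (mul_mem hb hc), by ring⟩
      add_mem' := by
        rintro _ _ ⟨a, ha, b, hb, rfl⟩ ⟨c, hc, e, he, rfl⟩
        exact ⟨a + c, add_mem ha hc, b + e, add_mem hb he, by ring⟩
      algebraMap_mem' := fun q => ⟨_, K.algebraMap_mem q, 0, zero_mem K, by simp⟩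
      inv_mem' := by
        rintro _ ⟨a, ha, b, hb, rfl⟩
        -- The norm can vanish for a non-zero element, since r may lie in K; then a = b * r and the
        -- element is 2 * a.
        by_cases h : a ^ 2 - b ^ 2 * r ^ 2 = 0
        · rcases mul_eq_zero.1 (show (a + b * r) * (a - b * r) = 0 by linear_combination h)
            with h | h
          · exact ⟨0, zero_mem K, 0, zero_mem K, by simp [h]⟩
          · refine ⟨(2 * a)⁻¹, inv_mem (mul_mem (ofNat_mem K 2) ha), 0, zero_mem K, ?_⟩
            rw [zero_mul, add_zero]
            congr 1
            linear_combination -h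
        · have hn : a ^ 2 - b ^ 2 * r ^ 2 ∈ K :=
            sub_mem (pow_mem ha 2) (mul_mem (pow_mem hb 2) hr)
          refine ⟨a / (a ^ 2 - b ^ 2 * r ^ 2), div_mem ha hn,
            -b / (a ^ 2 - b ^ 2 * r ^ 2), div_mem (neg_mem hb) hn, ?_⟩
          have h1 : a + b * r ≠ 0 := by
            rintro h1
            exact h (by linear_combination (a - b * r) * h1)
          field_simp
          ring }
  have hK : K ≤ S := fun a ha => ⟨a, ha, 0, zero_mem K, by simp⟩
  have hrS : F⟮r⟯ ≤ S := by
    rw [adjoin_simple_le_iff]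
    exact ⟨0, zero_mem K, 1, one_mem K, by simp⟩
  exact sup_le hK hrS hx

theorem coeff_eq_of_notMem {K : IntermediateField F L} {r : L} (hr : r ∉ K) {a b c e : L}
    (ha : a ∈ K) (hb : b ∈ K) (hc : c ∈ K) (he : e ∈ K) (h : a + b * r = c + e * r) :
    a = c ∧ b = e := by
  have hbe : b = e := by
    by_contra hne
    have h' : b - e ≠ 0 := sub_ne_zero.2 hne
    refine hr ?_
    have : r = (c - a) / (b - e) := by
      field_simp
      linear_combination h
    rw [this]
    exact div_mem (sub_mem hc ha) (sub_mem hb he)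
  subst hbe
  exact ⟨by linear_combination h, rfl⟩

/-- A square root, lying in `K(r)`, of an element of `K` lies in `K` or in `K * r`. -/
theorem sqrt_mem_or_mem_mul [NeZero (2 : L)] {K : IntermediateField F L} {r : L}
    (hr : r ^ 2 ∈ K) {x : L} (hx : x ∈ K ⊔ F⟮r⟯) (hx2 : x ^ 2 ∈ K) :
    x ∈ K ∨ ∃ q ∈ K, x = q * r := by
  by_cases hrK : r ∈ K
  · left
    have : K ⊔ F⟮r⟯ = K := sup_eq_left.2 (adjoin_simple_le_iff.2 hrK)
    rwa [this] at hx
  obtain ⟨a, ha, b, hb, rfl⟩ := mem_sup_adjoin_sqrt hr hx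
  have h := coeff_eq_of_notMem hrK (a := a ^ 2 + b ^ 2 * r ^ 2) (b := 2 * a * b)
    (add_mem (pow_mem ha 2) (mul_mem (pow_mem hb 2) hr))
    (mul_mem (mul_mem (ofNat_mem K 2) ha) hb) hx2 (zero_mem K) (by ring)
  rcases mul_eq_zero.1 h.2 with h0 | h0
  · rcases mul_eq_zero.1 h0 with h0 | h0
    · exact absurd h0 two_ne_zero
    · exact Or.inr ⟨b, hb, by rw [h0, zero_add]⟩
  · exact Or.inl (by simpa [h0] using ha)

theorem finrank_sup_adjoin_sqrt {K : IntermediateField F L} [FiniteDimensional F K] {r : L}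
    (hr : r ^ 2 ∈ K) (hrK : r ∉ K) :
    Module.finrank F (K ⊔ F⟮r⟯ : IntermediateField F L) = 2 * Module.finrank F K := by
  have hKr : K ≤ K ⊔ F⟮r⟯ := le_sup_left
  have hrr : r ∈ K ⊔ F⟮r⟯ := (le_sup_right : F⟮r⟯ ≤ _) (mem_adjoin_simple_self F r)
  let f : (K × K) →ₗ[F] (K ⊔ F⟮r⟯ : IntermediateField F L) :=
    { toFun := fun p => ⟨p.1 + p.2 * r, add_mem (hKr p.1.2) (mul_mem (hKr p.2.2) hrr)⟩
      map_add' := by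
        intro p q
        ext
        simp
        ring
      map_smul' := by
        intro c p
        ext
        simp [Algebra.smul_def]
        ring }
  have hf : Function.Bijective f := by
    constructor
    · rintro ⟨a, b⟩ ⟨c, e⟩ h
      have h' : (a : L) + b * r = c + e * r := congrArg Subtype.val h
      obtain ⟨h1, h2⟩ := coeff_eq_of_notMem hrK a.2 b.2 c.2 e.2 h'
      exact Prod.ext (Subtype.ext h1) (Subtype.ext h2)
    · rintro ⟨x, hx⟩
      obtain ⟨a, ha, b, hb, rfl⟩ := mem_sup_adjoin_sqrt hr hx
      exact ⟨(⟨a, ha⟩, ⟨b, hb⟩), rfl⟩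
  rw [← (LinearEquiv.ofBijective f hf).finrank_eq, Module.finrank_prod, two_mul]

theorem mem_of_sq_eq_sq {K : IntermediateField F L} {r a : L} (ha : a ∈ K)
    (h : r ^ 2 = a ^ 2) : r ∈ K := by
  rcases sq_eq_sq_iff_eq_or_eq_neg.1 h with rfl | rfl
  · exact ha
  · exact neg_mem ha

end QuadraticExtension

/-! ### Squares in ℚ and squarefree integers. -/

section RationalSquares

open IntermediateField

theorem eq_zero_of_sq_eq_two_mul_sq {a b : ℚ} (h : a ^ 2 = 2 * b ^ 2) : b = 0 := by
  by_contra hb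
  have h2 : IsSquare (2 : ℚ) := ⟨a / b, by field_simp; linarith⟩
  rw [Rat.isSquare_iff] at h2
  obtain ⟨n, hn⟩ := h2.1
  have hn' : n * n = 2 := by simpa using hn.symm
  have h1 : n ≤ 1 := by nlinarith
  have h2 : -1 ≤ n := by nlinarith
  interval_cases n <;> omega

theorem exists_int_eq_of_sq_eq {c : ℚ} {n : ℤ} (h : c ^ 2 = n) : ∃ m : ℤ, m ^ 2 = n := by
  have h2 : IsSquare (n : ℚ) := ⟨c, by rw [← h, sq]⟩
  rw [Rat.isSquare_intCast_iff] at h2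
  obtain ⟨m, hm⟩ := h2
  exact ⟨m, by rw [hm, sq]⟩

theorem Squarefree.eq_one_of_eq_sq {d m : ℤ} (hd : Squarefree d) (h : m ^ 2 = d) : d = 1 := by
  have hu : IsUnit m := hd m ⟨1, by rw [← h]; ring⟩
  rw [← h, Int.isUnit_sq hu]

theorem Squarefree.eq_two_of_eq_two_mul_sq {d : ℤ} {c : ℚ} (hd : Squarefree d)
    (h : (d : ℚ) = 2 * c ^ 2) : d = 2 := by
  obtain ⟨m, hm⟩ := exists_int_eq_of_sq_eq (c := 2 * c) (n := 2 * d) (by push_cast; rw [h]; ring)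
  have hme : Even m := by
    have : Even (m ^ 2) := ⟨d, by rw [hm]; ring⟩
    exact (Int.even_pow.1 this).1
  obtain ⟨k, rfl⟩ := hme
  have hk : d = 2 * k ^ 2 := by linarith [show (k + k) ^ 2 = 4 * k ^ 2 by ring]
  have hu : IsUnit k := hd k ⟨2, by rw [hk]; ring⟩
  rw [hk, Int.isUnit_sq hu]
  norm_num

end RationalSquares

/-! ### Non-squares in ℚ(i). -/

section GaussianNumbers

open IntermediateField

variable {L : Type*} [Field L] [CharZero L] {i : L}

theorem exists_ratCast_of_mem_bot {x : L} (hx : x ∈ (⊥ : IntermediateField ℚ L)) :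
    ∃ a : ℚ, x = a := by
  obtain ⟨a, rfl⟩ := mem_bot.1 hx
  exact ⟨a, by simp⟩

theorem sqrt_neg_one_notMem_bot (hi : i ^ 2 = -1) : i ∉ (⊥ : IntermediateField ℚ L) := by
  intro h
  obtain ⟨a, rfl⟩ := exists_ratCast_of_mem_bot h
  have : a ^ 2 = -1 := by exact_mod_cast hi
  nlinarith [sq_nonneg a]

theorem exists_of_mem_gaussian (hi : i ^ 2 = -1) {x : L} (hx : x ∈ ℚ⟮i⟯) :
    ∃ a b : ℚ, x = a + b * i := by
  have hx' : x ∈ (⊥ : IntermediateField ℚ L) ⊔ ℚ⟮i⟯ := by rwa [bot_sup_eq]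
  obtain ⟨a, ha, b, hb, rfl⟩ := mem_sup_adjoin_sqrt (by rw [hi]; exact neg_mem (one_mem _)) hx'
  obtain ⟨a, rfl⟩ := exists_ratCast_of_mem_bot ha
  obtain ⟨b, rfl⟩ := exists_ratCast_of_mem_bot hb
  exact ⟨a, b, rfl⟩

theorem gaussian_coeff_eq (hi : i ^ 2 = -1) {a b c e : ℚ}
    (h : (a : L) + b * i = c + e * i) : a = c ∧ b = e := by
  have := coeff_eq_of_notMem (sqrt_neg_one_notMem_bot hi) (SubfieldClass.ratCast_mem _ a)
    (SubfieldClass.ratCast_mem _ b)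
    (SubfieldClass.ratCast_mem _ c) (SubfieldClass.ratCast_mem _ e) h
  exact_mod_cast this

theorem exists_sq_coeff_of_mem_gaussian (hi : i ^ 2 = -1) {x : L} (hx : x ∈ ℚ⟮i⟯) {c e : ℚ}
    (h : x ^ 2 = c + e * i) : ∃ a b : ℚ, a ^ 2 - b ^ 2 = c ∧ 2 * a * b = e := by
  obtain ⟨a, b, rfl⟩ := exists_of_mem_gaussian hi hx
  refine ⟨a, b, gaussian_coeff_eq hi ?_⟩
  push_cast
  linear_combination h - (b : L) ^ 2 * hi

/-- Taking norms to ℚ turns the equation into (a² + b²)² = 2d². -/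
theorem eq_zero_of_sq_eq_mul_one_sub_I (hi : i ^ 2 = -1) {x : L} (hx : x ∈ ℚ⟮i⟯) {d : ℚ}
    (h : x ^ 2 = d * (1 - i)) : d = 0 := by
  obtain ⟨a, b, h1, h2⟩ := exists_sq_coeff_of_mem_gaussian hi hx (c := d) (e := -d)
    (by push_cast; linear_combination h)
  refine eq_zero_of_sq_eq_two_mul_sq (a := a ^ 2 + b ^ 2) ?_
  linear_combination (a ^ 2 - b ^ 2 + d) * h1 + (2 * a * b - d) * h2

/-- Otherwise -i = (x / y)² with x / y = a + bi. Norms give a² + b² = 1 and the real part gives a² =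
b², so 2a² = 1. -/
theorem eq_zero_of_sq_add_I_mul_sq (hi : i ^ 2 = -1) {x y : L} (hx : x ∈ ℚ⟮i⟯)
    (hy : y ∈ ℚ⟮i⟯) (h : x ^ 2 + i * y ^ 2 = 0) : y = 0 := by
  by_contra hy0
  obtain ⟨a, b, h1, h2⟩ := exists_sq_coeff_of_mem_gaussian hi (div_mem hx hy) (c := 0) (e := -1)
    (by
      push_cast
      field_simp
      linear_combination h)
  have h3 : (a ^ 2 + b ^ 2) ^ 2 = 1 := by
    linear_combination (a ^ 2 - b ^ 2) * h1 + (2 * a * b - 1) * h2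
  have h4 : a ^ 2 + b ^ 2 = 1 := by nlinarith [sq_nonneg a, sq_nonneg b]
  exact one_ne_zero (α := ℚ) (by
    have := eq_zero_of_sq_eq_two_mul_sq (a := 1) (b := a) (by linarith)
    subst this
    simp at h2)

end GaussianNumbers

/-! ### The tower from ℚ to ℚ(ζ₁₆, 2^(1/8)): non-squares and degrees. -/

section Tower

open IntermediateField

variable {L : Type*} [Field L] [CharZero L] {ζ u : L}

theorem zeta_ne_zero (hζ : ζ ^ 8 = -1) : ζ ≠ 0 := by
  rintro rfl
  norm_num at hζ

/-- ζ² - ζ⁶ is ζ₈ + ζ₈⁻¹; it serves as √2 throughout. -/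
theorem sqrt_two_sq {L : Type*} [Field L] {ζ : L} (hζ : ζ ^ 8 = -1) : (ζ ^ 2 - ζ ^ 6) ^ 2 = 2 := by
  linear_combination (ζ ^ 4 - 2) * hζ

theorem zeta_pow_four_sq {L : Type*} [Field L] {ζ : L} (hζ : ζ ^ 8 = -1) : (ζ ^ 4) ^ 2 = -1 := by
  linear_combination hζ

theorem mem_of_le_sup_left {K : IntermediateField ℚ L} {r x : L} (hx : x ∈ K) : x ∈ K ⊔ ℚ⟮r⟯ :=
  (le_sup_left : K ≤ K ⊔ ℚ⟮r⟯) hx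

theorem self_mem_sup_adjoin (K : IntermediateField ℚ L) (r : L) : r ∈ K ⊔ ℚ⟮r⟯ :=
  (le_sup_right : ℚ⟮r⟯ ≤ K ⊔ ℚ⟮r⟯) (mem_adjoin_simple_self ℚ r)

/-- The field `ℚ(i)`, where `i = ζ ^ 4`. -/
noncomputable def cyclotomicFour (ζ : L) : IntermediateField ℚ L := ℚ⟮ζ ^ 4⟯

/-- The field `ℚ(ζ₈)`, where `ζ₈ = ζ ^ 2`. -/
noncomputable def cyclotomicEight (ζ : L) : IntermediateField ℚ L := cyclotomicFour ζ ⊔ ℚ⟮ζ ^ 2⟯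

/-- The field `ℚ(ζ₁₆)`, where `ζ₁₆ = ζ`. -/
noncomputable def cyclotomicSixteen (ζ : L) : IntermediateField ℚ L := cyclotomicEight ζ ⊔ ℚ⟮ζ⟯

/-- The field `ℚ(ζ₁₆, u ^ 2)`, where `u ^ 4 = √2`. -/
noncomputable def kummerFour (ζ u : L) : IntermediateField ℚ L := cyclotomicSixteen ζ ⊔ ℚ⟮u ^ 2⟯

/-- The field `ℚ(ζ₁₆, u)`, where `u ^ 4 = √2`. -/
noncomputable def kummerEight (ζ u : L) : IntermediateField ℚ L := kummerFour ζ u ⊔ ℚ⟮u⟯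

/-- The field `ℚ(ζ₈, u ^ 2)`, where `u ^ 4 = √2`. -/
noncomputable def octicField (ζ u : L) : IntermediateField ℚ L := cyclotomicEight ζ ⊔ ℚ⟮u ^ 2⟯

theorem zeta_pow_four_mem (ζ : L) : ζ ^ 4 ∈ cyclotomicFour ζ := mem_adjoin_simple_self ℚ _

theorem zeta_sq_mem (ζ : L) : ζ ^ 2 ∈ cyclotomicEight ζ := self_mem_sup_adjoin _ _

theorem zeta_sq_sq_mem (ζ : L) : (ζ ^ 2) ^ 2 ∈ cyclotomicFour ζ := by
  rw [← pow_mul]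
  exact zeta_pow_four_mem ζ

theorem zeta_sq_notMem (hζ : ζ ^ 8 = -1) : ζ ^ 2 ∉ cyclotomicFour ζ := by
  intro h
  have := eq_zero_of_sq_add_I_mul_sq (zeta_pow_four_sq hζ) (pow_mem h 3)
    (one_mem _) (by linear_combination ζ ^ 4 * hζ)
  exact one_ne_zero this

/-- Write x = a + bζ² over ℚ(i). The part of x² in ℚ(i) is a² + ib², which vanishes only if b = 0,
and then c = 2ab = 0. -/
theorem eq_zero_of_mem_cyclotomicEight_of_sq_eq_mul_zeta_sq (hζ : ζ ^ 8 = -1) {x : L}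
    (hx : x ∈ cyclotomicEight ζ) {c : L} (hc : c ∈ cyclotomicFour ζ) (h : x ^ 2 = c * ζ ^ 2) :
    c = 0 := by
  obtain ⟨a, ha, b, hb, rfl⟩ := mem_sup_adjoin_sqrt (zeta_sq_sq_mem ζ) hx
  have hi := zeta_pow_four_mem ζ
  have h' := coeff_eq_of_notMem (zeta_sq_notMem hζ) (a := a ^ 2 + ζ ^ 4 * b ^ 2) (b := 2 * a * b)
    (c := 0) (e := c) (add_mem (pow_mem ha 2) (mul_mem hi (pow_mem hb 2)))
    (mul_mem (mul_mem (ofNat_mem _ 2) ha) hb) (zero_mem _) hc (by linear_combination h)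
  have hb0 := eq_zero_of_sq_add_I_mul_sq (zeta_pow_four_sq hζ) ha hb h'.1
  rw [← h'.2, hb0, mul_zero]

theorem zeta_notMem (hζ : ζ ^ 8 = -1) : ζ ∉ cyclotomicEight ζ := by
  intro h
  exact one_ne_zero (eq_zero_of_mem_cyclotomicEight_of_sq_eq_mul_zeta_sq hζ h (one_mem _)
    (one_mul _).symm)

theorem cyclotomicEight_le (ζ : L) : cyclotomicEight ζ ≤ cyclotomicSixteen ζ := le_sup_left

theorem sqrt_two_mem_cyclotomicEight (ζ : L) : ζ ^ 2 - ζ ^ 6 ∈ cyclotomicEight ζ := by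
  have h := zeta_sq_mem ζ
  have h6 : ζ ^ 6 = (ζ ^ 2) ^ 3 := by ring
  rw [h6]
  exact sub_mem h (pow_mem h 3)

theorem sqrt_two_mem_cyclotomicSixteen (ζ : L) : ζ ^ 2 - ζ ^ 6 ∈ cyclotomicSixteen ζ :=
  cyclotomicEight_le ζ (sqrt_two_mem_cyclotomicEight ζ)

/-- No non-zero rational multiple of `√2` is a square in `ℚ(ζ₁₆)`. -/
theorem eq_zero_of_mem_cyclotomicSixteen_of_sq (hζ : ζ ^ 8 = -1) {x : L}
    (hx : x ∈ cyclotomicSixteen ζ) {d : ℚ} (h : x ^ 2 = d * (ζ ^ 2 - ζ ^ 6)) : d = 0 := by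
  have hi := zeta_pow_four_mem ζ
  have hii := zeta_pow_four_sq hζ
  have hd : (d : L) ∈ cyclotomicFour ζ := SubfieldClass.ratCast_mem _ d
  have h1i : (1 - ζ ^ 4 : L) ≠ 0 := by
    intro h0
    have h1 : ζ ^ 4 = 1 := by linear_combination -h0
    rw [h1] at hii
    norm_num at hii
  -- As √2 = (1 - i)ζ², the descent to ℚ(ζ₈) leaves either d(1 - i)ζ² or d(1 - i) as a square.
  rcases sqrt_mem_or_mem_mul (zeta_sq_mem ζ) hx
      (by rw [h]; exact mul_mem (SubfieldClass.ratCast_mem _ d) (sqrt_two_mem_cyclotomicEight ζ))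
    with hx' | ⟨q, hq, rfl⟩
  · have := eq_zero_of_mem_cyclotomicEight_of_sq_eq_mul_zeta_sq hζ hx' (c := d * (1 - ζ ^ 4))
      (mul_mem hd (sub_mem (one_mem _) hi)) (by linear_combination h)
    exact_mod_cast (mul_eq_zero.1 this).resolve_right h1i
  · have hq2 : q ^ 2 = d * (1 - ζ ^ 4) := by
      have := zeta_ne_zero hζ
      apply mul_right_cancel₀ (pow_ne_zero 2 this)
      linear_combination h
    rcases sqrt_mem_or_mem_mul (zeta_sq_sq_mem ζ) hq
        (by rw [hq2]; exact mul_mem hd (sub_mem (one_mem _) hi)) with hq' | ⟨p, hp, rfl⟩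
    · exact eq_zero_of_sq_eq_mul_one_sub_I hii hq' hq2
    -- Here ip² = d(1 - i); since (1 - i)² = -2i, multiplying p by 1 - i removes the factor i.
    · have := eq_zero_of_sq_eq_mul_one_sub_I hii (x := p * (1 - ζ ^ 4)) (d := -2 * d)
        (mul_mem hp (sub_mem (one_mem _) hi))
        (by
          push_cast
          linear_combination (-2 : L) * hq2 + p ^ 2 * hii)
      linarith

theorem u_sq_sq_mem_cyclotomicSixteen (hu : u ^ 4 = ζ ^ 2 - ζ ^ 6) :
    (u ^ 2) ^ 2 ∈ cyclotomicSixteen ζ := by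
  rw [← pow_mul, hu]
  exact sqrt_two_mem_cyclotomicSixteen ζ

theorem u_sq_notMem (hζ : ζ ^ 8 = -1) (hu : u ^ 4 = ζ ^ 2 - ζ ^ 6) :
    u ^ 2 ∉ cyclotomicSixteen ζ := by
  intro h
  exact one_ne_zero (eq_zero_of_mem_cyclotomicSixteen_of_sq hζ h (d := 1)
    (by rw [← hu]; push_cast; ring))

theorem zeta_pow_four_mem_cyclotomicSixteen (ζ : L) : ζ ^ 4 ∈ cyclotomicSixteen ζ :=
  cyclotomicEight_le ζ (mem_of_le_sup_left (zeta_pow_four_mem ζ))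

/-- No non-zero rational multiple of `2 ^ (1 / 4)` is a square in `ℚ(ζ₁₆, 2 ^ (1 / 4))`. -/
theorem eq_zero_of_mem_kummerFour_of_sq (hζ : ζ ^ 8 = -1) (hu : u ^ 4 = ζ ^ 2 - ζ ^ 6) {x : L}
    (hx : x ∈ kummerFour ζ u) {d : ℚ} (h : x ^ 2 = d * u ^ 2) : d = 0 := by
  by_contra hd
  have hw := u_sq_sq_mem_cyclotomicSixteen hu
  obtain ⟨a, ha, b, hb, rfl⟩ := mem_sup_adjoin_sqrt hw hx
  have h' := coeff_eq_of_notMem (u_sq_notMem hζ hu) (a := a ^ 2 + b ^ 2 * (u ^ 2) ^ 2)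
    (b := 2 * a * b) (c := 0) (e := d) (add_mem (pow_mem ha 2) (mul_mem (pow_mem hb 2) hw))
    (mul_mem (mul_mem (ofNat_mem _ 2) ha) hb) (zero_mem _) (SubfieldClass.ratCast_mem _ d)
    (by linear_combination h)
  have hb0 : b ≠ 0 := by
    rintro rfl
    exact hd (by simpa using h'.2.symm)
  -- The vanishing part a² + b²√2 makes -√2 a square, hence √2 too because i is available.
  have := eq_zero_of_mem_cyclotomicSixteen_of_sq hζ (x := ζ ^ 4 * (a / b)) (d := 1)
    (mul_mem (zeta_pow_four_mem_cyclotomicSixteen ζ) (div_mem ha hb))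
    (by
      rw [← hu]
      push_cast
      field_simp
      linear_combination a ^ 2 * hζ - h'.1)
  exact one_ne_zero this

theorem u_notMem (hζ : ζ ^ 8 = -1) (hu : u ^ 4 = ζ ^ 2 - ζ ^ 6) : u ∉ kummerFour ζ u := by
  intro h
  exact one_ne_zero (eq_zero_of_mem_kummerFour_of_sq hζ hu h (d := 1) (by push_cast; ring))

theorem u_sq_mem_kummerFour (ζ u : L) : u ^ 2 ∈ kummerFour ζ u := self_mem_sup_adjoin _ _

theorem cyclotomicSixteen_le (ζ u : L) : cyclotomicSixteen ζ ≤ kummerFour ζ u := le_sup_left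

theorem kummerFour_le (ζ u : L) : kummerFour ζ u ≤ kummerEight ζ u := le_sup_left

theorem u_ne_zero (hζ : ζ ^ 8 = -1) (hu : u ^ 4 = ζ ^ 2 - ζ ^ 6) : u ≠ 0 := by
  rintro rfl
  have := sqrt_two_sq hζ
  rw [← hu] at this
  norm_num at this

/-- The rational numbers that become squares in `ℚ(ζ₁₆, 2 ^ (1 / 8))`. -/
theorem exists_sq_of_mem_kummerEight (hζ : ζ ^ 8 = -1) (hu : u ^ 4 = ζ ^ 2 - ζ ^ 6) {s : L}
    (hs : s ∈ kummerEight ζ u) {d : ℚ} (hd : d ≠ 0) (h : s ^ 2 = d) :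
    ∃ c : ℚ, d = c ^ 2 ∨ d = -c ^ 2 ∨ d = 2 * c ^ 2 ∨ d = -(2 * c ^ 2) := by
  have hd2 : ∀ K : IntermediateField ℚ L, s ^ 2 ∈ K := fun K => by
    rw [h]
    exact SubfieldClass.ratCast_mem K d
  have hii := zeta_pow_four_sq hζ
  have hu0 := u_ne_zero hζ hu
  -- Descent floor by floor. If s = q * r with r the generator of the floor, then q * r² is a square
  -- root of d * r² one floor down. This is impossible for r = u, u² and ζ; only the step from ℚ(ζ₈)
  -- to ℚ(i) lets both cases survive.
  rcases sqrt_mem_or_mem_mul (u_sq_mem_kummerFour ζ u) hs (hd2 _) with hs | ⟨q, hq, rfl⟩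
  swap
  · exact absurd (eq_zero_of_mem_kummerFour_of_sq hζ hu (x := q * u ^ 2)
      (mul_mem hq (u_sq_mem_kummerFour ζ u)) (d := d) (by linear_combination u ^ 2 * h)) hd
  rcases sqrt_mem_or_mem_mul (u_sq_sq_mem_cyclotomicSixteen hu) hs (hd2 _)
    with hs | ⟨q, hq, rfl⟩
  swap
  · exact absurd (eq_zero_of_mem_cyclotomicSixteen_of_sq hζ (x := q * (u ^ 2) ^ 2)
      (mul_mem hq (u_sq_sq_mem_cyclotomicSixteen hu)) (d := d)
      (by rw [← hu]; linear_combination u ^ 4 * h)) hd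
  rcases sqrt_mem_or_mem_mul (zeta_sq_mem ζ) hs (hd2 _) with hs | ⟨q, hq, rfl⟩
  swap
  · refine absurd (eq_zero_of_mem_cyclotomicEight_of_sq_eq_mul_zeta_sq hζ
      (x := q * ζ ^ 2) (mul_mem hq (zeta_sq_mem ζ)) (c := d) (SubfieldClass.ratCast_mem _ d)
      (by linear_combination ζ ^ 2 * h)) (by exact_mod_cast hd)
  rcases sqrt_mem_or_mem_mul (zeta_sq_sq_mem ζ) hs (hd2 _) with hs | ⟨q, hq, rfl⟩
  · obtain ⟨a, b, h1, h2⟩ := exists_sq_coeff_of_mem_gaussian hii hs (c := d) (e := 0)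
      (by rw [h]; push_cast; ring)
    rcases mul_eq_zero.1 h2 with h0 | rfl
    · obtain rfl : a = 0 := by simpa using h0
      exact ⟨b, Or.inr (Or.inl (by linarith))⟩
    · exact ⟨a, Or.inl (by linarith)⟩
  · obtain ⟨a, b, h1, h2⟩ := exists_sq_coeff_of_mem_gaussian hii hq (c := 0) (e := -d)
      (by push_cast; linear_combination -ζ ^ 4 * h + q ^ 2 * hζ)
    rcases sq_eq_sq_iff_eq_or_eq_neg.1 (sub_eq_zero.1 h1) with rfl | rfl
    · exact ⟨a, Or.inr (Or.inr (Or.inr (by linarith)))⟩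
    · exact ⟨b, Or.inr (Or.inr (Or.inl (by linarith)))⟩

theorem mem_pm_one_pm_two_of_mem_kummerEight (hζ : ζ ^ 8 = -1) (hu : u ^ 4 = ζ ^ 2 - ζ ^ 6)
    {d : ℤ} (hd : Squarefree d) {s : L} (hs : s ^ 2 = d) (h : s ∈ kummerEight ζ u) :
    d ∈ ({1, -1, 2, -2} : Set ℤ) := by
  have hneg : Squarefree (-d) := by rwa [← Int.squarefree_natAbs, Int.natAbs_neg,
    Int.squarefree_natAbs]
  obtain ⟨c, h | h | h | h⟩ := exists_sq_of_mem_kummerEight hζ hu h (d := d)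
    (by exact_mod_cast hd.ne_zero) (by rw [hs]; simp)
  · obtain ⟨m, hm⟩ := exists_int_eq_of_sq_eq h.symm
    simp [hd.eq_one_of_eq_sq hm]
  · obtain ⟨m, hm⟩ := exists_int_eq_of_sq_eq (c := c) (n := -d) (by push_cast; linarith)
    have := hneg.eq_one_of_eq_sq hm
    have : d = -1 := by omega
    simp [this]
  · simp [hd.eq_two_of_eq_two_mul_sq h]
  · have := hneg.eq_two_of_eq_two_mul_sq (c := c) (by push_cast; linarith)
    have : d = -2 := by omega
    simp [this]

theorem zeta_sq_mem_octicField (ζ u : L) : ζ ^ 2 ∈ octicField ζ u :=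
  mem_of_le_sup_left (zeta_sq_mem ζ)

theorem u_sq_mem_octicField (ζ u : L) : u ^ 2 ∈ octicField ζ u := self_mem_sup_adjoin _ _

/-- The required roots are products of i = (ζ²)² and √2 = ζ² - (ζ²)³ up to sign. -/
theorem mem_octicField_of_mem_pm_one_pm_two (hζ : ζ ^ 8 = -1) {d : ℤ}
    (hd : d ∈ ({1, -1, 2, -2} : Set ℤ)) {s : L} (hs : s ^ 2 = d) : s ∈ octicField ζ u := by
  have hz := zeta_sq_mem_octicField ζ u
  rcases hd with rfl | rfl | rfl | rfl
  · exact mem_of_sq_eq_sq (one_mem _) (by rw [hs]; push_cast; ring)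
  · exact mem_of_sq_eq_sq (a := (ζ ^ 2) ^ 2) (pow_mem hz 2)
      (by rw [hs]; push_cast; linear_combination -hζ)
  · exact mem_of_sq_eq_sq (a := ζ ^ 2 - (ζ ^ 2) ^ 3) (sub_mem hz (pow_mem hz 3))
      (by rw [hs]; push_cast; linear_combination -sqrt_two_sq hζ)
  · exact mem_of_sq_eq_sq (a := (ζ ^ 2) ^ 2 * (ζ ^ 2 - (ζ ^ 2) ^ 3))
      (mul_mem (pow_mem hz 2) (sub_mem hz (pow_mem hz 3)))
      (by rw [hs]; push_cast; linear_combination -ζ ^ 8 * sqrt_two_sq hζ - 2 * hζ)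

theorem octicField_le (ζ u : L) : octicField ζ u ≤ kummerEight ζ u :=
  (sup_le_sup_right (cyclotomicEight_le ζ) _).trans (kummerFour_le ζ u)

theorem finiteDimensional_of_finrank_ne_zero {K : IntermediateField ℚ L}
    (h : Module.finrank ℚ K ≠ 0) : FiniteDimensional ℚ K :=
  Module.finite_of_finrank_pos (Nat.pos_of_ne_zero h)

theorem finrank_cyclotomicEight (hζ : ζ ^ 8 = -1) :
    Module.finrank ℚ (cyclotomicEight ζ) = 4 := by
  have h4 : Module.finrank ℚ (cyclotomicFour ζ) = 2 := by
    have := finrank_sup_adjoin_sqrt (K := (⊥ : IntermediateField ℚ L)) (r := ζ ^ 4)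
      (by rw [zeta_pow_four_sq hζ]; exact neg_mem (one_mem _))
      (sqrt_neg_one_notMem_bot (zeta_pow_four_sq hζ))
    rwa [bot_sup_eq, IntermediateField.finrank_bot] at this
  have := finiteDimensional_of_finrank_ne_zero (h4.trans_ne two_ne_zero)
  rw [cyclotomicEight, finrank_sup_adjoin_sqrt (zeta_sq_sq_mem ζ) (zeta_sq_notMem hζ), h4]

theorem finrank_octicField (hζ : ζ ^ 8 = -1) (hu : u ^ 4 = ζ ^ 2 - ζ ^ 6) :
    Module.finrank ℚ (octicField ζ u) = 8 := by
  have h8 := finrank_cyclotomicEight hζ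
  have := finiteDimensional_of_finrank_ne_zero (h8.trans_ne four_ne_zero)
  rw [octicField, finrank_sup_adjoin_sqrt
    (by rw [← pow_mul, hu]; exact sqrt_two_mem_cyclotomicEight ζ)
    (fun h => u_sq_notMem hζ hu (cyclotomicEight_le ζ h)), h8]

theorem finrank_kummerEight (hζ : ζ ^ 8 = -1) (hu : u ^ 4 = ζ ^ 2 - ζ ^ 6) :
    Module.finrank ℚ (kummerEight ζ u) = 32 := by
  have h8 := finrank_cyclotomicEight hζ
  have := finiteDimensional_of_finrank_ne_zero (h8.trans_ne four_ne_zero)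
  have h16 : Module.finrank ℚ (cyclotomicSixteen ζ) = 8 := by
    rw [cyclotomicSixteen, finrank_sup_adjoin_sqrt (zeta_sq_mem ζ) (zeta_notMem hζ), h8]
  have := finiteDimensional_of_finrank_ne_zero (h16.trans_ne (by norm_num))
  have h4 : Module.finrank ℚ (kummerFour ζ u) = 16 := by
    rw [kummerFour, finrank_sup_adjoin_sqrt (u_sq_sq_mem_cyclotomicSixteen hu)
      (u_sq_notMem hζ hu), h16]
  have := finiteDimensional_of_finrank_ne_zero (h4.trans_ne (by norm_num))
  rw [kummerEight, finrank_sup_adjoin_sqrt (u_sq_mem_kummerFour ζ u) (u_notMem hζ hu), h4]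

end Tower

/-! ### The roots of f₄ and f₈ as primitive elements. -/

section PrimitiveElements

open IntermediateField

variable {L : Type*} [Field L] [CharZero L] {ζ u : L}

theorem natDegree_polyFour : polyFour.natDegree = 8 := by
  unfold polyFour
  compute_degree!

theorem monic_polyFour : polyFour.Monic := by
  unfold polyFour
  monicity!

theorem natDegree_polyEight : polyEight.natDegree = 32 := by
  unfold polyEight
  compute_degree!

theorem monic_polyEight : polyEight.Monic := by
  unfold polyEight
  monicity!

/-- Irreducibility of p is not needed: ℚ(x) has degree at most deg p and contains a field of exactly
that degree. -/
theorem eq_adjoin_of_aeval_eq_zero {K : IntermediateField ℚ L} {p : ℚ[X]} (hp : p.Monic) {x : L}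
    (hx : aeval x p = 0) (hK : K ≤ ℚ⟮x⟯) (hn : Module.finrank ℚ K = p.natDegree) :
    K = ℚ⟮x⟯ := by
  have hint : IsIntegral ℚ x := ⟨p, hp, by rwa [← aeval_def]⟩
  have := adjoin.finiteDimensional hint
  refine eq_of_le_of_finrank_le hK ?_
  rw [hn, adjoin.finrank hint]
  exact natDegree_le_of_dvd (minpoly.dvd ℚ x hx) hp.ne_zero

/-- The solutions are the odd powers of ζ, found by extracting square roots three times. -/
theorem mem_of_pow_eight_eq_neg_one {K : IntermediateField ℚ L} (hζ : ζ ^ 8 = -1) {x : L}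
    (hx : x ^ 8 = -1) (h : ζ ∈ K) : x ∈ K := by
  have h2 : x ^ 4 = ζ ^ 4 ∨ x ^ 4 = -ζ ^ 4 :=
    sq_eq_sq_iff_eq_or_eq_neg.1 (by linear_combination hx - hζ)
  rcases h2 with h2 | h2
  · rcases sq_eq_sq_iff_eq_or_eq_neg.1 (show (x ^ 2) ^ 2 = (ζ ^ 2) ^ 2 by linear_combination h2)
      with h3 | h3
    · exact mem_of_sq_eq_sq h h3
    · exact mem_of_sq_eq_sq (pow_mem h 5) (by linear_combination h3 - ζ ^ 2 * hζ)
  · rcases sq_eq_sq_iff_eq_or_eq_neg.1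
      (show (x ^ 2) ^ 2 = (ζ ^ 6) ^ 2 by linear_combination h2 - ζ ^ 4 * hζ) with h3 | h3
    · exact mem_of_sq_eq_sq (pow_mem h 3) (by linear_combination h3)
    · exact mem_of_sq_eq_sq (pow_mem h 7) (by linear_combination h3 - ζ ^ 6 * hζ)

theorem mem_of_pow_eight_eq_one {K : IntermediateField ℚ L} (hζ : ζ ^ 8 = -1) {x : L}
    (hx : x ^ 8 = 1) (h : ζ ^ 2 ∈ K) : x ∈ K := by
  have h2 : x ^ 4 = 1 ∨ x ^ 4 = -1 :=
    sq_eq_sq_iff_eq_or_eq_neg.1 (by linear_combination hx)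
  rcases h2 with h2 | h2
  · rcases sq_eq_sq_iff_eq_or_eq_neg.1 (show (x ^ 2) ^ 2 = 1 ^ 2 by linear_combination h2)
      with h3 | h3
    · exact mem_of_sq_eq_sq (one_mem K) (by linear_combination h3)
    · exact mem_of_sq_eq_sq (pow_mem h 2) (by linear_combination h3 - hζ)
  · rcases sq_eq_sq_iff_eq_or_eq_neg.1
      (show (x ^ 2) ^ 2 = (ζ ^ 4) ^ 2 by linear_combination h2 - hζ) with h3 | h3
    · exact mem_of_sq_eq_sq h (by linear_combination h3)
    · exact mem_of_sq_eq_sq (pow_mem h 3) (by linear_combination h3 - ζ ^ 4 * hζ)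

theorem u_pow_eight {L : Type*} [Field L] {ζ u : L} (hζ : ζ ^ 8 = -1)
    (hu : u ^ 4 = ζ ^ 2 - ζ ^ 6) : u ^ 8 = 2 := by
  linear_combination (u ^ 4 + (ζ ^ 2 - ζ ^ 6)) * hu + sqrt_two_sq hζ

theorem mem_of_pow_eight_eq_two {K : IntermediateField ℚ L} (hζ : ζ ^ 8 = -1)
    (hu : u ^ 4 = ζ ^ 2 - ζ ^ 6) {x : L} (hx : x ^ 8 = 2) (h : ζ ^ 2 ∈ K) (huK : u ∈ K) :
    x ∈ K := by
  have hu0 := u_ne_zero hζ hu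
  have h1 : (x / u) ^ 8 = 1 := by
    rw [div_pow, hx, u_pow_eight hζ hu]
    exact div_self two_ne_zero
  have := mul_mem (mem_of_pow_eight_eq_one hζ h1 h) huK
  rwa [div_mul_cancel₀ _ hu0] at this

theorem octicField_le_of_mem {K : IntermediateField ℚ L} (hz : ζ ^ 2 ∈ K) (ht : u ^ 2 ∈ K) :
    octicField ζ u ≤ K := by
  refine sup_le (sup_le ?_ ?_) ?_ <;> refine adjoin_simple_le_iff.2 ?_
  · have := pow_mem hz 2
    rwa [← pow_mul] at this
  · exact hz
  · exact ht

theorem kummerEight_le_of_mem {K : IntermediateField ℚ L} (hζ : ζ ∈ K) (hu : u ∈ K) :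
    kummerEight ζ u ≤ K := by
  refine sup_le (sup_le (sup_le (sup_le ?_ ?_) ?_) ?_) ?_ <;> refine adjoin_simple_le_iff.2 ?_
  exacts [pow_mem hζ 4, pow_mem hζ 2, hζ, pow_mem hu 2, hu]

theorem zeta_mem_kummerEight (ζ u : L) : ζ ∈ kummerEight ζ u :=
  kummerFour_le ζ u (cyclotomicSixteen_le ζ u (self_mem_sup_adjoin _ _))

theorem u_mem_kummerEight (ζ u : L) : u ∈ kummerEight ζ u := self_mem_sup_adjoin _ _

/-- Every root of `polyFour` generates `ℚ(ζ₈, 2 ^ (1 / 4))`. -/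
theorem octicField_eq_adjoin (hζ : ζ ^ 8 = -1) (hu : u ^ 4 = ζ ^ 2 - ζ ^ 6) {α : L}
    (hα : aeval α polyFour = 0) : octicField ζ u = ℚ⟮α⟯ := by
  refine eq_adjoin_of_aeval_eq_zero monic_polyFour hα ?_
    (by rw [finrank_octicField hζ hu, natDegree_polyFour])
  have hpoly : (α ^ 2 - 1) ^ 4 + 2 * α ^ 4 = 0 := by
    simp only [polyFour, map_add, map_sub, map_mul, map_pow, aeval_X, map_ofNat, map_one] at hα
    linear_combination hα
  have hα0 : α ≠ 0 := by
    rintro rfl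
    norm_num at hpoly
  have hαK := mem_adjoin_simple_self ℚ α
  obtain ⟨w, hw⟩ : ∃ w, w = (α ^ 2 - 1) / α := ⟨_, rfl⟩
  have hwK : w ∈ ℚ⟮α⟯ := by
    rw [hw]
    exact div_mem (sub_mem (pow_mem hαK 2) (one_mem _)) hαK
  have hw1 : α ^ 2 - 1 = w * α := by rw [hw]; field_simp
  have hw4 : w ^ 4 = -2 := by
    apply mul_right_cancel₀ (pow_ne_zero 4 hα0)
    rw [hw1] at hpoly
    linear_combination hpoly
  have hw0 : w ≠ 0 := by
    rintro rfl
    norm_num at hw4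
  have hw2 : 1 + w ^ 2 ≠ 0 := by
    intro h
    have : (1 : L) = -2 := by
      linear_combination hw4 - (w ^ 2 - 1) * h
    norm_num [eq_neg_iff_add_eq_zero] at this
  -- α is a root of T² - wT - 1, whose discriminant w² + 4 equals -((1 + w²)w)² because w⁴ = -2. So
  -- j is a square root of -1.
  obtain ⟨j, hj⟩ : ∃ j, j = (2 * α - w) / ((1 + w ^ 2) * w) := ⟨_, rfl⟩
  have hjK : j ∈ ℚ⟮α⟯ := by
    rw [hj]
    exact div_mem (sub_mem (mul_mem (ofNat_mem _ 2) hαK) hwK)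
      (mul_mem (add_mem (one_mem _) (pow_mem hwK 2)) hwK)
  have hj2 : j ^ 2 = -1 := by
    rw [hj, div_pow, div_eq_iff (pow_ne_zero 2 (mul_ne_zero hw2 hw0))]
    linear_combination 4 * hw1 + (w ^ 2 + 2) * hw4
  have hiK : ζ ^ 4 ∈ ℚ⟮α⟯ := mem_of_sq_eq_sq hjK (by rw [hj2, zeta_pow_four_sq hζ])
  -- (i w²)² = -w⁴ = 2.
  have hw2i : (ζ ^ 2 - ζ ^ 6) ∈ ℚ⟮α⟯ :=
    mem_of_sq_eq_sq (mul_mem hiK (pow_mem hwK 2)) (by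
      linear_combination sqrt_two_sq hζ - ζ ^ 8 * hw4 + 2 * hζ)
  have hzK : ζ ^ 2 ∈ ℚ⟮α⟯ := by
    have h1 : (1 - ζ ^ 4 : L) ≠ 0 := by
      intro h
      have h1 : ζ ^ 4 = 1 := by linear_combination -h
      have h2 := zeta_pow_four_sq hζ
      rw [h1] at h2
      norm_num at h2
    have h2 : ζ ^ 2 = (ζ ^ 2 - ζ ^ 6) / (1 - ζ ^ 4) := by
      field_simp
    rw [h2]
    exact div_mem hw2i (sub_mem (one_mem _) hiK)
  refine octicField_le_of_mem hzK ?_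
  -- u² is a fourth root of ±2 up to a root of unity, as is ζ²w: both have eighth power 4.
  have h8 : (u ^ 2 / (ζ ^ 2 * w)) ^ 8 = 1 := by
    have h1 : (u ^ 2) ^ 8 = 4 := by linear_combination (u ^ 8 + 2) * u_pow_eight hζ hu
    have h2 : (ζ ^ 2 * w) ^ 8 = 4 := by
      linear_combination (ζ ^ 8 - 1) * w ^ 8 * hζ + (w ^ 4 - 2) * hw4
    rw [div_pow, h1, h2]
    exact div_self (by norm_num)
  have h9 := mul_mem (mem_of_pow_eight_eq_one hζ h8 hzK) (mul_mem hzK hwK)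
  rwa [div_mul_cancel₀ _ (mul_ne_zero (pow_ne_zero 2 (zeta_ne_zero hζ)) hw0)] at h9

/-- A primitive element of `ℚ(ζ₁₆, 2 ^ (1 / 8))`. -/
noncomputable def primitiveElement (ζ u : L) : L :=
  (ζ ^ 2 + ζ * (u ^ 2 + u ^ 4) + ζ ^ 2 * u ^ 7 - 1) / 2

theorem primitiveElement_mem {K : IntermediateField ℚ L} (hζ : ζ ∈ K) (hu : u ∈ K) :
    primitiveElement ζ u ∈ K :=
  div_mem (sub_mem (add_mem (add_mem (pow_mem hζ 2)
    (mul_mem hζ (add_mem (pow_mem hu 2) (pow_mem hu 4))))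
    (mul_mem (pow_mem hζ 2) (pow_mem hu 7))) (one_mem K)) (ofNat_mem K 2)

/-- f₈ is a norm computed one quadratic step at a time. With b twice the element plus 1, `h₀`
isolates the term ζ²u⁷ and squares it, which eliminates u. Each of `h₂` to `h₅` multiplies the
preceding relation by its conjugate, replacing in turn t, ζ, ζ², ζ⁴ by its negative in the reduced
form. The degree in b goes 2, 4, 8, 16, 32. -/
theorem aeval_primitiveElement (hζ : ζ ^ 8 = -1) (hu : u ^ 4 = ζ ^ 2 - ζ ^ 6) :
    aeval (primitiveElement ζ u) polyEight = 0 := by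
  obtain ⟨b, hb⟩ : ∃ b, b = ζ ^ 2 + ζ * (u ^ 2 + u ^ 4) + ζ ^ 2 * u ^ 7 := ⟨_, rfl⟩
  obtain ⟨t, htu⟩ : ∃ t, t = u ^ 2 := ⟨_, rfl⟩
  have ht : t ^ 2 = ζ ^ 2 - ζ ^ 6 := by
    rw [htu, ← hu]
    ring
  have h₀ : (b - ζ ^ 2 - ζ * t - ζ * (ζ ^ 2 - ζ ^ 6)) ^ 2
      = 2 * ζ ^ 4 * (ζ ^ 2 - ζ ^ 6) * t := by
    rw [← hu, htu, hb]
    linear_combination ζ ^ 4 * u ^ 6 * u_pow_eight hζ hu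
  have h₁ : b ^ 2 + 1 + 2 * ζ - 2 * b * ζ ^ 2 + 2 * ζ ^ 2 - 2 * b * ζ ^ 3 + 2 * ζ ^ 4
      + 2 * ζ ^ 5 + 2 * b * ζ ^ 7 + 2 * t - 2 * b * ζ * t - 2 * ζ ^ 2 * t
      + 2 * ζ ^ 3 * t + 2 * ζ ^ 4 * t - 2 * ζ ^ 6 * t = 0 := by
    linear_combination h₀ + (-ζ ^ 2) * ht
      + (1 + 2 * ζ + 2 * ζ ^ 2 - ζ ^ 6 + 2 * t - 2 * ζ ^ 2 * t) * hζ
  have h₂ : b ^ 4 - 2 * b ^ 2 - 15 + 12 * b ^ 2 * ζ - 8 * b * ζ - 4 * ζ - 4 * b ^ 3 * ζ ^ 2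
      + 12 * b ^ 2 * ζ ^ 2 + 4 * b * ζ ^ 2 + 4 * ζ ^ 2 - 4 * b ^ 3 * ζ ^ 3
      - 4 * b * ζ ^ 3 + 8 * ζ ^ 3 + 4 * b ^ 2 * ζ ^ 4 - 24 * b * ζ ^ 4 + 20 * ζ ^ 4
      + 12 * b ^ 2 * ζ ^ 5 - 24 * b * ζ ^ 5 - 4 * ζ ^ 5 + 4 * b ^ 3 * ζ ^ 7
      - 12 * b * ζ ^ 7 + 24 * ζ ^ 7 = 0 := by
    linear_combination (b ^ 2 + 1 + 2 * ζ - 2 * b * ζ ^ 2 + 2 * ζ ^ 2 - 2 * b * ζ ^ 3 + 2 * ζ ^ 4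
      + 2 * ζ ^ 5 + 2 * b * ζ ^ 7 - 2 * t + 2 * b * ζ * t + 2 * ζ ^ 2 * t
      - 2 * ζ ^ 3 * t - 2 * ζ ^ 4 * t + 2 * ζ ^ 6 * t) * h₁
      + (4 - 8 * b * ζ + 4 * b ^ 2 * ζ ^ 2 - 8 * ζ ^ 2 + 8 * b * ζ ^ 3 + 8 * ζ ^ 3
      - 8 * b * ζ ^ 4 + 12 * ζ ^ 4 - 8 * b * ζ ^ 5 - 8 * ζ ^ 5 - 12 * ζ ^ 6
      + 8 * b * ζ ^ 7 + 8 * ζ ^ 7 + 12 * ζ ^ 8 - 8 * ζ ^ 9 - 8 * ζ ^ 10 + 4 * ζ ^ 12) * ht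
      + (-4 * b ^ 2 - 16 + 8 * b ^ 2 * ζ - 8 * b * ζ - 8 * ζ + 8 * b ^ 2 * ζ ^ 2
      + 8 * b * ζ ^ 2 - 8 * b * ζ ^ 4 + 4 * ζ ^ 4 - 8 * b * ζ ^ 5 - 8 * ζ ^ 5
      - 4 * b ^ 2 * ζ ^ 6 - 8 * ζ ^ 6 + 8 * ζ ^ 7 + 8 * ζ ^ 8 - 4 * ζ ^ 10) * hζ
  have h₃ : b ^ 8 - 4 * b ^ 6 + 86 * b ^ 4 - 192 * b ^ 3 + 476 * b ^ 2 + 320 * b - 431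
      - 8 * b ^ 7 * ζ ^ 2 - 8 * b ^ 6 * ζ ^ 2 + 24 * b ^ 5 * ζ ^ 2
      + 24 * b ^ 4 * ζ ^ 2 - 408 * b ^ 3 * ζ ^ 2 + 232 * b ^ 2 * ζ ^ 2
      - 376 * b * ζ ^ 2 + 264 * ζ ^ 2 + 24 * b ^ 6 * ζ ^ 4 + 48 * b ^ 5 * ζ ^ 4
      - 120 * b ^ 4 * ζ ^ 4 - 96 * b ^ 3 * ζ ^ 4 + 808 * b ^ 2 * ζ ^ 4
      - 208 * b * ζ ^ 4 - 712 * ζ ^ 4 - 32 * b ^ 5 * ζ ^ 6 - 128 * b ^ 4 * ζ ^ 6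
      + 320 * b ^ 3 * ζ ^ 6 + 256 * b ^ 2 * ζ ^ 6 - 800 * b * ζ ^ 6 + 640 * ζ ^ 6 = 0 := by
    linear_combination (b ^ 4 - 2 * b ^ 2 - 15 - 12 * b ^ 2 * ζ + 8 * b * ζ + 4 * ζ
      - 4 * b ^ 3 * ζ ^ 2 + 12 * b ^ 2 * ζ ^ 2 + 4 * b * ζ ^ 2 + 4 * ζ ^ 2 + 4 * b ^ 3 * ζ ^ 3
      + 4 * b * ζ ^ 3 - 8 * ζ ^ 3 + 4 * b ^ 2 * ζ ^ 4 - 24 * b * ζ ^ 4 + 20 * ζ ^ 4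
      - 12 * b ^ 2 * ζ ^ 5 + 24 * b * ζ ^ 5 + 4 * ζ ^ 5 - 4 * b ^ 3 * ζ ^ 7
      + 12 * b * ζ ^ 7 - 24 * ζ ^ 7) * h₂
      + (112 * b ^ 4 - 192 * b ^ 3 + 416 * b ^ 2 + 320 * b - 656 - 32 * b ^ 6 * ζ ^ 2
      + 208 * b ^ 4 * ζ ^ 2 - 704 * b ^ 3 * ζ ^ 2 + 576 * b ^ 2 * ζ ^ 2
      - 192 * b * ζ ^ 2 + 400 * ζ ^ 2 + 96 * b ^ 5 * ζ ^ 4 - 192 * b ^ 4 * ζ ^ 4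
      - 320 * b ^ 3 * ζ ^ 4 + 1152 * b ^ 2 * ζ ^ 4 - 1056 * b * ζ ^ 4 - 192 * ζ ^ 4
      + 16 * b ^ 6 * ζ ^ 6 - 96 * b ^ 4 * ζ ^ 6 + 192 * b ^ 3 * ζ ^ 6
      + 144 * b ^ 2 * ζ ^ 6 - 576 * b * ζ ^ 6 + 576 * ζ ^ 6) * hζ
  have h₄ : b ^ 16 - 8 * b ^ 14 + 124 * b ^ 12 - 128 * b ^ 11 - 888 * b ^ 10 + 1408 * b ^ 9
      + 2790 * b ^ 8 - 6400 * b ^ 7 + 28232 * b ^ 6 + 57088 * b ^ 5 - 340036 * b ^ 4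
      - 247424 * b ^ 3 + 1833144 * b ^ 2 - 1475712 * b + 16737 - 16 * b ^ 14 * ζ ^ 4
      - 32 * b ^ 13 * ζ ^ 4 - 112 * b ^ 12 * ζ ^ 4 + 192 * b ^ 11 * ζ ^ 4
      + 1008 * b ^ 10 * ζ ^ 4 + 3616 * b ^ 9 * ζ ^ 4 - 11504 * b ^ 8 * ζ ^ 4
      + 640 * b ^ 7 * ζ ^ 4 + 10064 * b ^ 6 * ζ ^ 4 - 33248 * b ^ 5 * ζ ^ 4
      - 214992 * b ^ 4 * ζ ^ 4 + 1065152 * b ^ 3 * ζ ^ 4 - 803632 * b ^ 2 * ζ ^ 4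
      - 1101856 * b * ζ ^ 4 + 953648 * ζ ^ 4 = 0 := by
    linear_combination (b ^ 8 - 4 * b ^ 6 + 86 * b ^ 4 - 192 * b ^ 3 + 476 * b ^ 2 + 320 * b - 431
      + 8 * b ^ 7 * ζ ^ 2 + 8 * b ^ 6 * ζ ^ 2 - 24 * b ^ 5 * ζ ^ 2
      - 24 * b ^ 4 * ζ ^ 2 + 408 * b ^ 3 * ζ ^ 2 - 232 * b ^ 2 * ζ ^ 2
      + 376 * b * ζ ^ 2 - 264 * ζ ^ 2 + 24 * b ^ 6 * ζ ^ 4 + 48 * b ^ 5 * ζ ^ 4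
      - 120 * b ^ 4 * ζ ^ 4 - 96 * b ^ 3 * ζ ^ 4 + 808 * b ^ 2 * ζ ^ 4
      - 208 * b * ζ ^ 4 - 712 * ζ ^ 4 + 32 * b ^ 5 * ζ ^ 6 + 128 * b ^ 4 * ζ ^ 6
      - 320 * b ^ 3 * ζ ^ 6 - 256 * b ^ 2 * ζ ^ 6 + 800 * b * ζ ^ 6 - 640 * ζ ^ 6) * h₃
      + (-64 * b ^ 12 + 256 * b ^ 11 - 1152 * b ^ 10 - 768 * b ^ 9 + 64 * b ^ 8
      + 29184 * b ^ 7 - 93952 * b ^ 6 + 184832 * b ^ 5 - 369600 * b ^ 4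
      - 717568 * b ^ 3 + 2141056 * b ^ 2 - 1199872 * b - 169024
      + 1024 * b ^ 10 * ζ ^ 4 + 8192 * b ^ 9 * ζ ^ 4 - 4096 * b ^ 8 * ζ ^ 4
      - 98304 * b ^ 7 * ζ ^ 4 + 88064 * b ^ 6 * ζ ^ 4 + 327680 * b ^ 5 * ζ ^ 4
      - 610304 * b ^ 4 * ζ ^ 4 + 967680 * b ^ 2 * ζ ^ 4 - 1024000 * b * ζ ^ 4
      + 409600 * ζ ^ 4) * hζ
  have h₅ : b ^ 32 - 16 * b ^ 30 + 568 * b ^ 28 + 768 * b ^ 27 + 848 * b ^ 26 + 5888 * b ^ 25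
      + 3164 * b ^ 24 - 290304 * b ^ 23 - 244240 * b ^ 22 + 1085952 * b ^ 21
      + 4606728 * b ^ 20 - 3061504 * b ^ 19 + 11656656 * b ^ 18 - 63759104 * b ^ 17
      - 38421626 * b ^ 16 - 251728896 * b ^ 15 + 1204868432 * b ^ 14
      - 148632576 * b ^ 13 + 5050031752 * b ^ 12 - 19144465152 * b ^ 11
      + 3855249776 * b ^ 10 - 17490960128 * b ^ 9 + 145729546460 * b ^ 8
      - 131489144320 * b ^ 7 + 219564602576 * b ^ 6 - 1203240058368 * b ^ 5
      + 1967770457016 * b ^ 4 - 1616133837056 * b ^ 3 + 1920411114864 * b ^ 2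
      - 2150963524864 * b + 909724635073 = 0 := by
    linear_combination (b ^ 16 - 8 * b ^ 14 + 124 * b ^ 12 - 128 * b ^ 11 - 888 * b ^ 10
      + 1408 * b ^ 9
      + 2790 * b ^ 8 - 6400 * b ^ 7 + 28232 * b ^ 6 + 57088 * b ^ 5 - 340036 * b ^ 4
      - 247424 * b ^ 3 + 1833144 * b ^ 2 - 1475712 * b + 16737 + 16 * b ^ 14 * ζ ^ 4
      + 32 * b ^ 13 * ζ ^ 4 + 112 * b ^ 12 * ζ ^ 4 - 192 * b ^ 11 * ζ ^ 4
      - 1008 * b ^ 10 * ζ ^ 4 - 3616 * b ^ 9 * ζ ^ 4 + 11504 * b ^ 8 * ζ ^ 4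
      - 640 * b ^ 7 * ζ ^ 4 - 10064 * b ^ 6 * ζ ^ 4 + 33248 * b ^ 5 * ζ ^ 4
      + 214992 * b ^ 4 * ζ ^ 4 - 1065152 * b ^ 3 * ζ ^ 4 + 803632 * b ^ 2 * ζ ^ 4
      + 1101856 * b * ζ ^ 4 - 953648 * ζ ^ 4) * h₄
      + (256 * b ^ 28 + 1024 * b ^ 27 + 4608 * b ^ 26 + 1024 * b ^ 25 - 32000 * b ^ 24
      - 223232 * b ^ 23 - 52224 * b ^ 22 + 292864 * b ^ 21 + 4618496 * b ^ 20
      + 3148800 * b ^ 19 - 3117568 * b ^ 18 - 90919936 * b ^ 17 + 150196992 * b ^ 16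
      - 243429376 * b ^ 15 - 275982336 * b ^ 14 + 1247563776 * b ^ 13
      + 10451589888 * b ^ 12 - 33118430208 * b ^ 11 + 10585361920 * b ^ 10
      + 66955123712 * b ^ 9 - 64134201088 * b ^ 8 - 425517492224 * b ^ 7
      + 1572561728512 * b ^ 6 - 1301613791232 * b ^ 5 - 2111517234432 * b ^ 4
      + 3802533630976 * b ^ 3 - 318677454336 * b ^ 2 - 2101565541376 * b
      + 909444507904) * hζ
  have hβ : primitiveElement ζ u = (b - 1) / 2 := by rw [primitiveElement, hb]
  have hb' : b = 2 * primitiveElement ζ u + 1 := by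
    rw [hβ]
    ring
  generalize primitiveElement ζ u = β at hb'
  subst hb'
  simp only [polyEight, map_add, map_sub, map_mul, map_pow, aeval_X, map_ofNat]
  -- Substituting b = 2β + 1 multiplies the monic polynomial by 2³².
  linear_combination h₅ / 2 ^ 32

/-- An automorphism that fixes `primitiveElement ζ u` fixes `ζ` and `u`. -/
theorem eq_of_map_primitiveElement (hζ : ζ ^ 8 = -1) (hu : u ^ 4 = ζ ^ 2 - ζ ^ 6)
    (σ : L ≃ₐ[ℚ] L) (hσ : σ (primitiveElement ζ u) = primitiveElement ζ u) :
    σ ζ = ζ ∧ σ u = u := by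
  have hζ' : (σ ζ) ^ 8 = -1 := by rw [← map_pow, hζ, map_neg, map_one]
  have hu8 := u_pow_eight hζ hu
  have hu8' : (σ u) ^ 8 = 2 := by rw [← map_pow, hu8, map_ofNat]
  have hu0 := u_ne_zero hζ hu
  obtain ⟨ω, hω⟩ : ∃ ω, ω = σ u / u := ⟨_, rfl⟩
  have hσu : σ u = ω * u := by rw [hω, div_mul_cancel₀ _ hu0]
  have hω8 : ω ^ 8 = 1 := by
    rw [hω, div_pow, hu8, hu8']
    exact div_self two_ne_zero
  have hb : (σ ζ) ^ 2 + σ ζ * ((σ u) ^ 2 + (σ u) ^ 4) + (σ ζ) ^ 2 * (σ u) ^ 7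
      = ζ ^ 2 + ζ * (u ^ 2 + u ^ 4) + ζ ^ 2 * u ^ 7 := by
    simp only [primitiveElement, map_div₀, map_sub, map_add, map_mul, map_pow, map_one,
      map_ofNat] at hσ
    linear_combination 2 * hσ
  obtain ⟨ξ, hξ⟩ : ∃ ξ, ξ = σ ζ := ⟨_, rfl⟩
  rw [hσu, ← hξ] at hb
  rw [← hξ] at hζ'
  have hζ3 : ζ ∈ cyclotomicSixteen ζ := self_mem_sup_adjoin _ _
  have hξ3 : ξ ∈ cyclotomicSixteen ζ := mem_of_pow_eight_eq_neg_one hζ hζ' hζ3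
  have hω3 : ω ∈ cyclotomicSixteen ζ := mem_of_pow_eight_eq_one hζ hω8 (pow_mem hζ3 2)
  have hle := cyclotomicSixteen_le ζ u
  have ht := u_sq_mem_kummerFour ζ u
  have hpow : ∀ {x}, x ∈ kummerFour ζ u → ∀ {y}, y ∈ kummerFour ζ u →
      x ^ 2 + x * (y + y ^ 2) ∈ kummerFour ζ u := fun hx _ hy =>
    add_mem (pow_mem hx 2) (mul_mem hx (add_mem hy (pow_mem hy 2)))
  -- σ sends ζ to ξ and u to ωu, with ξ and ω in ℚ(ζ₁₆). Compare the coefficients of 1 and u over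
  -- `kummerFour ζ u`.
  obtain ⟨h1, h2⟩ := coeff_eq_of_notMem (u_notMem hζ hu)
    (a := ξ ^ 2 + ξ * (ω ^ 2 * u ^ 2 + (ω ^ 2 * u ^ 2) ^ 2))
    (b := ξ ^ 2 * ω ^ 7 * (u ^ 2) ^ 3)
    (c := ζ ^ 2 + ζ * (u ^ 2 + (u ^ 2) ^ 2)) (e := ζ ^ 2 * (u ^ 2) ^ 3)
    (hpow (hle hξ3) (mul_mem (pow_mem (hle hω3) 2) ht))
    (mul_mem (mul_mem (pow_mem (hle hξ3) 2) (pow_mem (hle hω3) 7)) (pow_mem ht 3))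
    (hpow (hle hζ3) ht) (mul_mem (pow_mem (hle hζ3) 2) (pow_mem ht 3))
    (by linear_combination hb)
  have h3 : ξ ^ 2 * ω ^ 7 = ζ ^ 2 :=
    mul_right_cancel₀ (pow_ne_zero 3 (pow_ne_zero 2 hu0)) h2
  -- Fourth powers remove ξ and ζ, as ξ⁸ = ζ⁸ = -1; what is left is ω²⁸ = 1.
  have h4 : ω ^ 4 = 1 := by
    have h5 : (ξ ^ 2 * ω ^ 7) ^ 4 = (ζ ^ 2) ^ 4 := by rw [h3]
    linear_combination -hζ - h5 + ω ^ 28 * hζ' - (ω ^ 20 + ω ^ 12 + ω ^ 4) * hω8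
  have hw := u_sq_sq_mem_cyclotomicSixteen hu
  -- With ω⁴ = 1 the constant part splits again, along 1 and u² over ℚ(ζ₁₆). The u² part squared
  -- gives ξ² = ζ², and then the constant part gives ξ = ζ.
  obtain ⟨h5, h6⟩ := coeff_eq_of_notMem (u_sq_notMem hζ hu)
    (a := ξ ^ 2 + ξ * (u ^ 2) ^ 2) (b := ξ * ω ^ 2)
    (c := ζ ^ 2 + ζ * (u ^ 2) ^ 2) (e := ζ)
    (add_mem (pow_mem hξ3 2) (mul_mem hξ3 hw)) (mul_mem hξ3 (pow_mem hω3 2))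
    (add_mem (pow_mem hζ3 2) (mul_mem hζ3 hw)) hζ3
    (by linear_combination h1 - ξ * u ^ 4 * h4)
  have h7 : ξ ^ 2 = ζ ^ 2 := by
    linear_combination (ξ * ω ^ 2 + ζ) * h6 - ξ ^ 2 * h4
  have h8 : ξ = ζ :=
    mul_right_cancel₀ (pow_ne_zero 2 (pow_ne_zero 2 hu0)) (by linear_combination h5 - h7)
  have h9 : ω ^ 7 = 1 :=
    mul_left_cancel₀ (pow_ne_zero 2 (zeta_ne_zero hζ))
      (by linear_combination h3 - ω ^ 7 * h7)
  have h10 : ω = 1 := by linear_combination hω8 - ω * h9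
  exact ⟨by rw [← hξ, h8], by rw [hσu, h10, one_mul]⟩

/-- Galois correspondence: the automorphisms fixing the element fix ζ and u, so both lie in the
field it generates. -/
theorem adjoin_primitiveElement [IsGalois ℚ L] (hζ : ζ ^ 8 = -1) (hu : u ^ 4 = ζ ^ 2 - ζ ^ 6) :
    kummerEight ζ u = ℚ⟮primitiveElement ζ u⟯ := by
  refine le_antisymm ?_ (adjoin_simple_le_iff.2
    (primitiveElement_mem (zeta_mem_kummerEight ζ u) (u_mem_kummerEight ζ u)))
  have key : ∀ σ ∈ ℚ⟮primitiveElement ζ u⟯.fixingSubgroup, σ ζ = ζ ∧ σ u = u := by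
    intro σ hσ
    rw [IntermediateField.mem_fixingSubgroup_iff] at hσ
    exact eq_of_map_primitiveElement hζ hu σ (hσ _ (mem_adjoin_simple_self ℚ _))
  rw [← InfiniteGalois.fixedField_fixingSubgroup ℚ⟮primitiveElement ζ u⟯]
  refine kummerEight_le_of_mem ?_ ?_ <;> rw [mem_fixedField_iff] <;> intro σ hσ
  exacts [(key σ hσ).1, (key σ hσ).2]

theorem minpoly_primitiveElement [IsGalois ℚ L] (hζ : ζ ^ 8 = -1)
    (hu : u ^ 4 = ζ ^ 2 - ζ ^ 6) : minpoly ℚ (primitiveElement ζ u) = polyEight := by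
  have hroot := aeval_primitiveElement hζ hu
  have hint : IsIntegral ℚ (primitiveElement ζ u) :=
    ⟨polyEight, monic_polyEight, by rwa [← aeval_def]⟩
  refine (eq_of_monic_of_dvd_of_natDegree_le (minpoly.monic hint) monic_polyEight
    (minpoly.dvd ℚ _ hroot) ?_).symm
  rw [natDegree_polyEight, ← adjoin.finrank hint, ← adjoin_primitiveElement hζ hu,
    finrank_kummerEight hζ hu]

/-- Every root of `polyEight` generates `ℚ(ζ₁₆, 2 ^ (1 / 8))`. -/
theorem kummerEight_eq_adjoin [IsGalois ℚ L] (hζ : ζ ^ 8 = -1) (hu : u ^ 4 = ζ ^ 2 - ζ ^ 6)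
    {β : L} (hβ : aeval β polyEight = 0) : kummerEight ζ u = ℚ⟮β⟯ := by
  have hmin := minpoly_primitiveElement hζ hu
  have hint : IsIntegral ℚ β := ⟨polyEight, monic_polyEight, by rwa [← aeval_def]⟩
  obtain ⟨σ, rfl⟩ := minpoly.exists_algEquiv_of_root'
    (Algebra.IsAlgebraic.isAlgebraic (R := ℚ) (primitiveElement ζ u))
    (by rw [hmin]; exact hβ)
  -- Normality of the field: it contains every eighth root of -1 and of 2.
  have hmem : σ (primitiveElement ζ u) ∈ kummerEight ζ u := by
    have h1 : σ (primitiveElement ζ u) = primitiveElement (σ ζ) (σ u) := by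
      simp only [primitiveElement, map_div₀, map_sub, map_add, map_mul, map_pow, map_one, map_ofNat]
    rw [h1]
    have hζK := zeta_mem_kummerEight ζ u
    refine primitiveElement_mem
      (mem_of_pow_eight_eq_neg_one hζ (by rw [← map_pow, hζ, map_neg, map_one]) hζK)
      (mem_of_pow_eight_eq_two hζ hu (by rw [← map_pow, u_pow_eight hζ hu, map_ofNat])
        (pow_mem hζK 2) (u_mem_kummerEight ζ u))
  have := finiteDimensional_of_finrank_ne_zero ((finrank_kummerEight hζ hu).trans_ne (by norm_num))
  refine (eq_of_le_of_finrank_le (adjoin_simple_le_iff.2 hmem) ?_).symm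
  rw [finrank_kummerEight hζ hu, adjoin.finrank hint, minpoly.algEquiv_eq, hmin,
    natDegree_polyEight]

end PrimitiveElements

/-! ### Halving points on y² = (x - e₁)(x - e₂)(x - e₃). -/

section Halving

open IntermediateField

open WeierstrassCurve

/-- `W` is the curve `y ^ 2 = (x - e₁) * (x - e₂) * (x - e₃)` with distinct `e₁`, `e₂`, `e₃`. -/
structure IsSplit {L : Type*} [Field L] (W : Affine L) (e₁ e₂ e₃ : L) : Prop where
  a₁ : W.a₁ = 0
  a₂ : W.a₂ = -(e₁ + e₂ + e₃)
  a₃ : W.a₃ = 0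
  a₄ : W.a₄ = e₁ * e₂ + e₁ * e₃ + e₂ * e₃
  a₆ : W.a₆ = -(e₁ * e₂ * e₃)
  ne₁₂ : e₁ ≠ e₂
  ne₁₃ : e₁ ≠ e₃
  ne₂₃ : e₂ ≠ e₃

variable {L : Type*} [Field L] {W : Affine L} {e₁ e₂ e₃ : L}

theorem IsSplit.equation_iff (hW : IsSplit W e₁ e₂ e₃) {x y : L} :
    W.Equation x y ↔ y ^ 2 = (x - e₁) * (x - e₂) * (x - e₃) := by
  rw [Affine.equation_iff, hW.a₁, hW.a₂, hW.a₃, hW.a₄, hW.a₆]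
  constructor <;> intro h <;> linear_combination h

theorem IsSplit.nonsingular [CharZero L] (hW : IsSplit W e₁ e₂ e₃) {x y : L}
    (h : y ^ 2 = (x - e₁) * (x - e₂) * (x - e₃)) : W.Nonsingular x y := by
  rw [Affine.nonsingular_iff', hW.equation_iff, hW.a₁, hW.a₂, hW.a₃, hW.a₄]
  refine ⟨h, ?_⟩
  by_contra! hc
  obtain ⟨h1, h2⟩ := hc
  obtain rfl : y = 0 := by
    have : 2 * y = 0 := by linear_combination h2
    simpa using this
  have h12 := sub_ne_zero.2 hW.ne₁₂
  have h13 := sub_ne_zero.2 hW.ne₁₃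
  have h23 := sub_ne_zero.2 hW.ne₂₃
  have h3 : (x - e₁) * (x - e₂) * (x - e₃) = 0 := by linear_combination -h
  rcases mul_eq_zero.1 h3 with h3 | h3
  · rcases mul_eq_zero.1 h3 with h3 | h3 <;> rw [sub_eq_zero] at h3 <;> subst h3
    · exact mul_ne_zero h12 h13 (by linear_combination -h1)
    · exact mul_ne_zero h12 h23 (by linear_combination h1)
  · rw [sub_eq_zero] at h3
    subst h3
    exact mul_ne_zero h13 h23 (by linear_combination -h1)

/-- The square roots that halve a point are rational functions of the coordinates of the half. -/
theorem IsSplit.sqrt_mem_of_half [CharZero L] {F : Type*} [Field F] [Algebra F L]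
    (hW : IsSplit W e₁ e₂ e₃) {K : IntermediateField F L} (h₁ : e₁ ∈ K) (h₂ : e₂ ∈ K)
    (h₃ : e₃ ∈ K) {X r₁ r₂ r₃ : L} (e1 : r₁ ^ 2 = X - e₁) (e2 : r₂ ^ 2 = X - e₂)
    (e3 : r₃ ^ 2 = X - e₃) (hx : X + r₁ * r₂ + r₁ * r₃ + r₂ * r₃ ∈ K)
    (hy : (r₁ + r₂) * (r₁ + r₃) * (r₂ + r₃) ∈ K) : r₁ ∈ K ∧ r₂ ∈ K ∧ r₃ ∈ K := by
  have h12 : r₁ + r₂ ≠ 0 := fun h0 => hW.ne₁₂ (by linear_combination e1 - e2 - (r₁ - r₂) * h0)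
  have h13 : r₁ + r₃ ≠ 0 := fun h0 => hW.ne₁₃ (by linear_combination e1 - e3 - (r₁ - r₃) * h0)
  have h23 : r₂ + r₃ ≠ 0 := fun h0 => hW.ne₂₃ (by linear_combination e2 - e3 - (r₂ - r₃) * h0)
  obtain ⟨x, hxe⟩ : ∃ x, x = X + r₁ * r₂ + r₁ * r₃ + r₂ * r₃ := ⟨_, rfl⟩
  obtain ⟨y, hye⟩ : ∃ y, y = (r₁ + r₂) * (r₁ + r₃) * (r₂ + r₃) := ⟨_, rfl⟩
  have hy0 : y ≠ 0 := hye ▸ mul_ne_zero (mul_ne_zero h12 h13) h23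
  rw [← hxe] at hx
  rw [← hye] at hy
  -- These factorisations make each pairwise sum of the rᵢ a product of two differences divided by
  -- y; the three sums determine the rᵢ.
  have hA : x - e₁ = (r₁ + r₂) * (r₁ + r₃) := by linear_combination hxe - e1
  have hB : x - e₂ = (r₁ + r₂) * (r₂ + r₃) := by linear_combination hxe - e2
  have hC : x - e₃ = (r₁ + r₃) * (r₂ + r₃) := by linear_combination hxe - e3
  have hs12 : r₁ + r₂ ∈ K := by
    rw [show r₁ + r₂ = (x - e₁) * (x - e₂) / y by rw [hA, hB, hye]; field_simp]
    exact div_mem (mul_mem (sub_mem hx h₁) (sub_mem hx h₂)) hy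
  have hs13 : r₁ + r₃ ∈ K := by
    rw [show r₁ + r₃ = (x - e₁) * (x - e₃) / y by rw [hA, hC, hye]; field_simp]
    exact div_mem (mul_mem (sub_mem hx h₁) (sub_mem hx h₃)) hy
  have hs23 : r₂ + r₃ ∈ K := by
    rw [show r₂ + r₃ = (x - e₂) * (x - e₃) / y by rw [hB, hC, hye]; field_simp]
    exact div_mem (mul_mem (sub_mem hx h₂) (sub_mem hx h₃)) hy
  refine ⟨?_, ?_, ?_⟩
  · rw [show r₁ = ((r₁ + r₂) + (r₁ + r₃) - (r₂ + r₃)) / 2 by ring]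
    exact div_mem (sub_mem (add_mem hs12 hs13) hs23) (ofNat_mem K 2)
  · rw [show r₂ = ((r₁ + r₂) + (r₂ + r₃) - (r₁ + r₃)) / 2 by ring]
    exact div_mem (sub_mem (add_mem hs12 hs23) hs13) (ofNat_mem K 2)
  · rw [show r₃ = ((r₁ + r₃) + (r₂ + r₃) - (r₁ + r₂)) / 2 by ring]
    exact div_mem (sub_mem (add_mem hs13 hs23) hs12) (ofNat_mem K 2)

variable [DecidableEq L]

/-- `x` is the first coordinate of an affine point of `W` that is killed by `n`. -/
def IsTorsionX (W : Affine L) (n : ℕ) (x : L) : Prop :=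
  ∃ (y : L) (h : W.Nonsingular x y), n • Affine.Point.some x y h = 0

theorem IsSplit.two_nsmul_eq_zero (hW : IsSplit W e₁ e₂ e₃) {x : L} (h : W.Nonsingular x 0) :
    2 • Affine.Point.some x 0 h = 0 := by
  rw [two_nsmul]
  exact Affine.Point.add_self_of_Y_eq (by rw [Affine.negY, hW.a₁, hW.a₃]; ring)

/-- Doubling a point with non-zero second coordinate, and recovering it from square roots of the
differences between the first coordinate of the double and `e₁`, `e₂`, `e₃`. -/
theorem IsSplit.exists_two_nsmul [CharZero L] (hW : IsSplit W e₁ e₂ e₃) {x y : L}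
    (h : W.Nonsingular x y) (hy : y ≠ 0) :
    ∃ (X Y : L) (hXY : W.Nonsingular X Y) (r₁ r₂ r₃ : L),
      2 • Affine.Point.some x y h = Affine.Point.some X Y hXY ∧
      r₁ ^ 2 = X - e₁ ∧ r₂ ^ 2 = X - e₂ ∧ r₃ ^ 2 = X - e₃ ∧
      x = X + r₁ * r₂ + r₁ * r₃ + r₂ * r₃ ∧ y = (r₁ + r₂) * (r₁ + r₃) * (r₂ + r₃) ∧
      2 * y * r₁ = (x - e₁) * (x - e₂) + (x - e₁) * (x - e₃) - (x - e₂) * (x - e₃) := by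
  have heq := hW.equation_iff.1 h.1
  have hy2 : 2 * y ≠ 0 := mul_ne_zero two_ne_zero hy
  have hneg : y ≠ W.negY x y := by
    rw [Affine.negY, hW.a₁, hW.a₃]
    intro h0
    exact hy2 (by linear_combination h0)
  have hslope : W.slope x x y y = (3 * x ^ 2 + 2 * W.a₂ * x + W.a₄) / (2 * y) := by
    rw [Affine.slope_of_Y_ne rfl hneg, Affine.negY, hW.a₁, hW.a₃]
    congr 1 <;> ring
  obtain ⟨A, hA⟩ : ∃ A, A = x - e₁ := ⟨_, rfl⟩
  obtain ⟨B, hB⟩ : ∃ B, B = x - e₂ := ⟨_, rfl⟩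
  obtain ⟨C, hC⟩ : ∃ C, C = x - e₃ := ⟨_, rfl⟩
  rw [← hA, ← hB, ← hC] at heq
  have hX : W.addX x x (W.slope x x y y) =
      ((A * B + A * C + B * C) / (2 * y)) ^ 2 - (A + B + C) + x := by
    rw [Affine.addX, hslope, hW.a₁, hW.a₂, hW.a₄, hA, hB, hC]
    ring
  -- The roots are forced: AB/y, AC/y, BC/y must be r₁ + r₂, r₁ + r₃, r₂ + r₃.
  refine ⟨_, _, _, (A * B + A * C - B * C) / (2 * y), (A * B + B * C - A * C) / (2 * y),
    (A * C + B * C - A * B) / (2 * y),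
    (two_nsmul _).trans (Affine.Point.add_self_of_Y_ne hneg), ?_⟩
  rw [hX]
  obtain ⟨h1, h2, h3⟩ : e₁ = x - A ∧ e₂ = x - B ∧ e₃ = x - C := by
    refine ⟨?_, ?_, ?_⟩ <;> simp only [hA, hB, hC] <;> ring
  rw [h1, h2, h3]
  refine ⟨?_, ?_, ?_, ?_, ?_, ?_⟩ <;> field_simp
  · linear_combination 4 * (B + C) * heq
  · linear_combination 4 * (A + C) * heq
  · linear_combination 4 * (A + B) * heq
  · linear_combination 4 * (A + B + C) * heq
  · linear_combination 8 * (y ^ 2 + A * B * C) * heq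
  · ring

theorem IsSplit.eq_of_isTorsionX_two [CharZero L] (hW : IsSplit W e₁ e₂ e₃) {x : L}
    (h : IsTorsionX W 2 x) : x = e₁ ∨ x = e₂ ∨ x = e₃ := by
  obtain ⟨y, hxy, h2⟩ := h
  by_cases hy : y = 0
  · have heq := hW.equation_iff.1 hxy.1
    rw [hy, zero_pow two_ne_zero, eq_comm, mul_eq_zero, mul_eq_zero] at heq
    simpa only [sub_eq_zero, or_assoc] using heq
  · obtain ⟨X, Y, hXY, -, -, -, h', -⟩ := hW.exists_two_nsmul hxy hy
    rw [h'] at h2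
    exact absurd h2 (Affine.Point.some_ne_zero hXY)

theorem IsSplit.isTorsionX_two [CharZero L] (hW : IsSplit W e₁ e₂ e₃) {x : L}
    (h : x = e₁ ∨ x = e₂ ∨ x = e₃) : IsTorsionX W 2 x := by
  refine ⟨0, hW.nonsingular ?_, hW.two_nsmul_eq_zero _⟩
  rcases h with rfl | rfl | rfl <;> ring

/-- The points killed by `2 * n` have coordinates in any field that contains the square roots of
the differences between the first coordinates of the points killed by `n` and `e₁`, `e₂`, `e₃`. -/
theorem IsSplit.mem_of_two_mul_nsmul_eq_zero [CharZero L] {F : Type*} [Field F] [Algebra F L]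
    (hW : IsSplit W e₁ e₂ e₃) {K : IntermediateField F L} (h₁ : e₁ ∈ K) (h₂ : e₂ ∈ K)
    (h₃ : e₃ ∈ K) {n : ℕ}
    (hK : ∀ X, IsTorsionX W n X → ∀ r, (r ^ 2 = X - e₁ ∨ r ^ 2 = X - e₂ ∨ r ^ 2 = X - e₃) → r ∈ K)
    {x y : L} (h : W.Nonsingular x y) (hn : (2 * n) • Affine.Point.some x y h = 0) :
    x ∈ K ∧ y ∈ K := by
  by_cases hy : y = 0
  · subst hy
    refine ⟨?_, zero_mem K⟩
    rcases hW.eq_of_isTorsionX_two ⟨0, h, hW.two_nsmul_eq_zero h⟩ with rfl | rfl | rfl <;>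
      assumption
  · obtain ⟨X, Y, hXY, r₁, r₂, r₃, h', e1, e2, e3, hx, hy, -⟩ := hW.exists_two_nsmul h hy
    have hX : IsTorsionX W n X := ⟨Y, hXY, by rw [← h', ← mul_nsmul]; exact hn⟩
    have hr₁ := hK X hX r₁ (Or.inl e1)
    have hr₂ := hK X hX r₂ (Or.inr (Or.inl e2))
    have hr₃ := hK X hX r₃ (Or.inr (Or.inr e3))
    have hXK : X ∈ K := by
      rw [show X = r₁ ^ 2 + e₁ by rw [e1]; ring]
      exact add_mem (pow_mem hr₁ 2) h₁
    rw [hx, hy]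
    exact ⟨add_mem (add_mem (add_mem hXK (mul_mem hr₁ hr₂)) (mul_mem hr₁ hr₃)) (mul_mem hr₂ hr₃),
      mul_mem (mul_mem (add_mem hr₁ hr₂) (add_mem hr₁ hr₃)) (add_mem hr₂ hr₃)⟩

/-- Halving a point. -/
theorem IsSplit.exists_half [CharZero L] (hW : IsSplit W e₁ e₂ e₃) {n : ℕ} {X : L}
    (hX : IsTorsionX W n X) {r₁ r₂ r₃ : L} (e1 : r₁ ^ 2 = X - e₁) (e2 : r₂ ^ 2 = X - e₂)
    (e3 : r₃ ^ 2 = X - e₃) :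
    ∃ h : W.Nonsingular (X + r₁ * r₂ + r₁ * r₃ + r₂ * r₃) ((r₁ + r₂) * (r₁ + r₃) * (r₂ + r₃)),
      (2 * n) • Affine.Point.some _ _ h = 0 := by
  have h₁ : e₁ = X - r₁ ^ 2 := by rw [e1]; ring
  have h₂ : e₂ = X - r₂ ^ 2 := by rw [e2]; ring
  have h₃ : e₃ = X - r₃ ^ 2 := by rw [e3]; ring
  have h12 : r₁ + r₂ ≠ 0 := fun h0 => hW.ne₁₂ (by linear_combination h₁ - h₂ - (r₁ - r₂) * h0)
  have h13 : r₁ + r₃ ≠ 0 := fun h0 => hW.ne₁₃ (by linear_combination h₁ - h₃ - (r₁ - r₃) * h0)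
  have h23 : r₂ + r₃ ≠ 0 := fun h0 => hW.ne₂₃ (by linear_combination h₂ - h₃ - (r₂ - r₃) * h0)
  have hns : W.Nonsingular (X + r₁ * r₂ + r₁ * r₃ + r₂ * r₃)
      ((r₁ + r₂) * (r₁ + r₃) * (r₂ + r₃)) := hW.nonsingular (by rw [h₁, h₂, h₃]; ring)
  have hy0 := mul_ne_zero (mul_ne_zero h12 h13) h23
  refine ⟨hns, ?_⟩
  obtain ⟨X', Y', hXY', s₁, -, -, h', f1, -, -, -, -, hs₁⟩ :=
    hW.exists_two_nsmul hns hy0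
  obtain ⟨Y, hXY, hn⟩ := hX
  obtain rfl : s₁ = r₁ := by
    apply mul_left_cancel₀ (mul_ne_zero two_ne_zero hy0)
    rw [hs₁, h₁, h₂, h₃]
    ring
  obtain rfl : X' = X := by linear_combination e1 - f1
  rw [mul_nsmul, h']
  -- The double is only known up to sign, which does not affect being killed by n.
  rcases Affine.Point.X_eq_iff.1 (rfl : X' = X') with h0 | h0
  · rw [h0, hn]
  · rw [h0, neg_nsmul, hn, neg_zero]

/-- The first coordinates of the points killed by `4`. -/
theorem IsSplit.eq_of_isTorsionX_four [CharZero L] (hW : IsSplit W e₁ e₂ e₃) {x : L}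
    (h : IsTorsionX W 4 x) : (x = e₁ ∨ x = e₂ ∨ x = e₃) ∨
      (x - e₁) ^ 2 = (e₁ - e₂) * (e₁ - e₃) ∨ (x - e₂) ^ 2 = (e₂ - e₁) * (e₂ - e₃) ∨
      (x - e₃) ^ 2 = (e₃ - e₁) * (e₃ - e₂) := by
  obtain ⟨y, hxy, h4⟩ := h
  by_cases hy : y = 0
  · subst hy
    exact Or.inl (hW.eq_of_isTorsionX_two ⟨0, hxy, hW.two_nsmul_eq_zero hxy⟩)
  · right
    obtain ⟨X, Y, hXY, r₁, r₂, r₃, h', e1, e2, e3, hx, -⟩ := hW.exists_two_nsmul hxy hy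
    have hX : IsTorsionX W 2 X := ⟨Y, hXY, by rw [← h', ← mul_nsmul]; exact h4⟩
    -- If the double has X = eⱼ, then rⱼ = 0 and x - eⱼ is the product of the other two roots.
    rcases hW.eq_of_isTorsionX_two hX with rfl | rfl | rfl
    · obtain rfl : r₁ = 0 := by simpa using e1
      left
      rw [hx, ← e2, ← e3]
      ring
    · obtain rfl : r₂ = 0 := by simpa using e2
      right; left
      rw [hx, ← e1, ← e3]
      ring
    · obtain rfl : r₃ = 0 := by simpa using e3
      right; right
      rw [hx, ← e1, ← e2]
      ring

end Halving

/-! ### The 2-, 4- and 8-division fields of the twists. -/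

section DivisionFields

open IntermediateField

open WeierstrassCurve

open Classical in
theorem mem_divisionField {F : Type*} [Field F] (E : WeierstrassCurve F) {n : ℕ}
    {x y : AlgebraicClosure F} (h : (E.baseChange (AlgebraicClosure F)).toAffine.Nonsingular x y)
    (hn : n • Affine.Point.some x y h = 0) : x ∈ divisionField E n ∧ y ∈ divisionField E n :=
  ⟨subset_adjoin F _ ⟨x, y, h, hn, Or.inl rfl⟩, subset_adjoin F _ ⟨x, y, h, hn, Or.inr rfl⟩⟩

open Classical in
theorem divisionField_le {F : Type*} [Field F] (E : WeierstrassCurve F) {n : ℕ}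
    {K : IntermediateField F (AlgebraicClosure F)}
    (hK : ∀ (x y : AlgebraicClosure F)
      (h : (E.baseChange (AlgebraicClosure F)).toAffine.Nonsingular x y),
      n • Affine.Point.some x y h = 0 → x ∈ K ∧ y ∈ K) : divisionField E n ≤ K := by
  refine adjoin_le_iff.2 ?_
  rintro z ⟨x, y, h, hn, rfl | rfl⟩
  exacts [(hK _ _ h hn).1, (hK _ _ h hn).2]

open Classical in
theorem divisionField_le_divisionField {F : Type*} [Field F] (E : WeierstrassCurve F) {m n : ℕ}
    (hmn : m ∣ n) : divisionField E m ≤ divisionField E n := by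
  obtain ⟨k, rfl⟩ := hmn
  refine divisionField_le E fun x y h hm => mem_divisionField E h ?_
  rw [mul_nsmul, hm, nsmul_zero]

variable {d : ℤ} {w : AlgebraicClosure ℚ}

theorem isSplit_twistCurve (hd : d ≠ 0) (hw : w ^ 2 = 2) :
    IsSplit ((twistCurve d).baseChange (AlgebraicClosure ℚ)).toAffine
      (2 * d) (d * (-1 + 2 * w)) (d * (-1 - 2 * w)) := by
  have hd' : (d : AlgebraicClosure ℚ) ≠ 0 := by exact_mod_cast hd
  have hw0 : w ≠ 0 := by
    rintro rfl
    norm_num at hw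
  constructor
  · simp [twistCurve]
  · simp [twistCurve]
    ring
  · simp [twistCurve]
  · simp [twistCurve]
    linear_combination 4 * (d : AlgebraicClosure ℚ) ^ 2 * hw
  · simp [twistCurve]
    linear_combination -8 * (d : AlgebraicClosure ℚ) ^ 3 * hw
  · intro h
    have h1 : 3 - 2 * w = 0 := mul_left_cancel₀ hd' (by linear_combination h)
    exact one_ne_zero (α := AlgebraicClosure ℚ) (by linear_combination (3 + 2 * w) * h1 + 4 * hw)
  · intro h
    have h1 : 3 + 2 * w = 0 := mul_left_cancel₀ hd' (by linear_combination h)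
    exact one_ne_zero (α := AlgebraicClosure ℚ) (by linear_combination (3 - 2 * w) * h1 + 4 * hw)
  · intro h
    have h1 : 4 * w = 0 := mul_left_cancel₀ hd' (by linear_combination h)
    exact hw0 (by simpa using h1)

theorem two_torsion_mem {K : IntermediateField ℚ (AlgebraicClosure ℚ)} (hw : w ∈ K) :
    (2 * d : AlgebraicClosure ℚ) ∈ K ∧ d * (-1 + 2 * w) ∈ K ∧ d * (-1 - 2 * w) ∈ K := by
  have h2 : (2 : AlgebraicClosure ℚ) ∈ K := ofNat_mem K 2
  have hd : (d : AlgebraicClosure ℚ) ∈ K := intCast_mem K d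
  have h1 : (-1 : AlgebraicClosure ℚ) ∈ K := neg_mem (one_mem K)
  exact ⟨mul_mem h2 hd, mul_mem hd (add_mem h1 (mul_mem h2 hw)),
    mul_mem hd (sub_mem h1 (mul_mem h2 hw))⟩

open Classical in
theorem sqrt_two_mem_divisionField (hd : d ≠ 0) (hw : w ^ 2 = 2) :
    w ∈ divisionField (twistCurve d) 2 := by
  have hd' : (d : AlgebraicClosure ℚ) ≠ 0 := by exact_mod_cast hd
  obtain ⟨y, h, h2⟩ := (isSplit_twistCurve hd hw).isTorsionX_two
    (x := d * (-1 + 2 * w)) (Or.inr (Or.inl rfl))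
  have hmem := (mem_divisionField _ h h2).1
  rw [show w = (d * (-1 + 2 * w) / d + 1) / 2 by field_simp; ring]
  exact div_mem (add_mem (div_mem hmem (intCast_mem _ d)) (one_mem _)) (ofNat_mem _ 2)

open Classical in
theorem divisionField_two (hd : d ≠ 0) (hw : w ^ 2 = 2) :
    divisionField (twistCurve d) 2 = ℚ⟮w⟯ := by
  refine le_antisymm (divisionField_le _ fun x y h h2 => ?_)
    (adjoin_simple_le_iff.2 (sqrt_two_mem_divisionField hd hw))
  have hW := isSplit_twistCurve hd hw
  have hx := hW.eq_of_isTorsionX_two ⟨y, h, h2⟩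
  obtain ⟨h₁, h₂, h₃⟩ := two_torsion_mem (d := d) (mem_adjoin_simple_self ℚ w)
  have hy := hW.equation_iff.1 h.1
  have hy0 : y ^ 2 = 0 := by
    rw [hy]
    rcases hx with hx | hx | hx <;> rw [hx] <;> ring
  refine ⟨?_, ?_⟩
  · rcases hx with hx | hx | hx <;> rw [hx] <;> assumption
  · rw [pow_eq_zero_iff two_ne_zero] at hy0
    rw [hy0]
    exact zero_mem _

open Classical in
theorem sqrt_mem_divisionField (hd : d ≠ 0) (hw : w ^ 2 = 2) {m : ℕ} {X : AlgebraicClosure ℚ}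
    (hX : IsTorsionX ((twistCurve d).baseChange (AlgebraicClosure ℚ)).toAffine m X)
    {r₁ r₂ r₃ : AlgebraicClosure ℚ} (e1 : r₁ ^ 2 = X - 2 * d)
    (e2 : r₂ ^ 2 = X - d * (-1 + 2 * w)) (e3 : r₃ ^ 2 = X - d * (-1 - 2 * w)) :
    r₁ ∈ divisionField (twistCurve d) (2 * m) ∧ r₂ ∈ divisionField (twistCurve d) (2 * m) ∧
      r₃ ∈ divisionField (twistCurve d) (2 * m) := by
  have hW := isSplit_twistCurve hd hw
  have hwK : w ∈ divisionField (twistCurve d) (2 * m) :=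
    divisionField_le_divisionField _ (dvd_mul_right 2 m) (sqrt_two_mem_divisionField hd hw)
  obtain ⟨h₁, h₂, h₃⟩ := two_torsion_mem (d := d) hwK
  obtain ⟨h, hn⟩ := hW.exists_half hX e1 e2 e3
  obtain ⟨hx, hy⟩ := mem_divisionField _ h hn
  exact hW.sqrt_mem_of_half h₁ h₂ h₃ e1 e2 e3 hx hy

variable {ζ u s : AlgebraicClosure ℚ}

/-- The differences of the eᵢ are d(1 - w)², d(1 + w)² and 4dw up to sign, with square roots s(1 -
w), s(1 + w) and 2st; i takes care of the sign. -/
theorem sqrt_two_torsion_sub_mem {K : IntermediateField ℚ (AlgebraicClosure ℚ)}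
    {i t : AlgebraicClosure ℚ} (hi : i ^ 2 = -1) (ht : t ^ 2 = w) (hw : w ^ 2 = 2) (hs : s ^ 2 = d)
    (hiK : i ∈ K) (htK : t ∈ K) (hsK : s ∈ K) {X r : AlgebraicClosure ℚ}
    (hX : X = 2 * d ∨ X = d * (-1 + 2 * w) ∨ X = d * (-1 - 2 * w))
    (hr : r ^ 2 = X - 2 * d ∨ r ^ 2 = X - d * (-1 + 2 * w) ∨ r ^ 2 = X - d * (-1 - 2 * w)) :
    r ∈ K := by
  have hwK : w ∈ K := ht ▸ pow_mem htK 2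
  have h1 : s * (1 - w) ∈ K := mul_mem hsK (sub_mem (one_mem K) hwK)
  have h2 : s * (1 + w) ∈ K := mul_mem hsK (add_mem (one_mem K) hwK)
  have h3 : 2 * s * t ∈ K := mul_mem (mul_mem (ofNat_mem K 2) hsK) htK
  rcases hX with rfl | rfl | rfl <;> rcases hr with hr | hr | hr
  · exact mem_of_sq_eq_sq (zero_mem K) (by linear_combination hr)
  · exact mem_of_sq_eq_sq h1 (by linear_combination hr - (1 - w) ^ 2 * hs - d * hw)
  · exact mem_of_sq_eq_sq h2 (by linear_combination hr - (1 + w) ^ 2 * hs - d * hw)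
  · exact mem_of_sq_eq_sq (mul_mem hiK h1)
      (by linear_combination hr - s ^ 2 * (1 - w) ^ 2 * hi + (1 - w) ^ 2 * hs + d * hw)
  · exact mem_of_sq_eq_sq (zero_mem K) (by linear_combination hr)
  · exact mem_of_sq_eq_sq h3 (by linear_combination hr - 4 * s ^ 2 * ht - 4 * w * hs)
  · exact mem_of_sq_eq_sq (mul_mem hiK h2)
      (by linear_combination hr - s ^ 2 * (1 + w) ^ 2 * hi + (1 + w) ^ 2 * hs + d * hw)
  · exact mem_of_sq_eq_sq (mul_mem hiK h3)
      (by linear_combination hr - 4 * s ^ 2 * t ^ 2 * hi + 4 * s ^ 2 * ht + 4 * w * hs)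
  · exact mem_of_sq_eq_sq (zero_mem K) (by linear_combination hr)

theorem sqrt_ne_zero (hd : d ≠ 0) (hs : s ^ 2 = d) : s ≠ 0 := by
  rintro rfl
  rw [zero_pow two_ne_zero] at hs
  exact hd (by exact_mod_cast hs.symm)

theorem zeta_sq_mem_of_sqrt_two_mem {K : IntermediateField ℚ (AlgebraicClosure ℚ)}
    (hζ : ζ ^ 8 = -1) (hi : ζ ^ 4 ∈ K) (hw : ζ ^ 2 - ζ ^ 6 ∈ K) : ζ ^ 2 ∈ K := by
  rw [show ζ ^ 2 = (1 + ζ ^ 4) * (ζ ^ 2 - ζ ^ 6) / 2 by linear_combination ζ ^ 2 / 2 * hζ]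
  exact div_mem (mul_mem (add_mem (one_mem K) hi) hw) (ofNat_mem K 2)

open Classical in
/-- The first coordinates of some points killed by `4`. -/
theorem isTorsionX_four (hd : d ≠ 0) {i t : AlgebraicClosure ℚ} (hi : i ^ 2 = -1)
    (ht : t ^ 2 = w) (hw : w ^ 2 = 2) (hs : s ^ 2 = d) :
    IsTorsionX ((twistCurve d).baseChange (AlgebraicClosure ℚ)).toAffine 4 (3 * d) ∧
    IsTorsionX ((twistCurve d).baseChange (AlgebraicClosure ℚ)).toAffine 4
      (d * (-1 - 2 * w) + 2 * d * (1 + w) * t) := by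
  have hW := isSplit_twistCurve hd hw
  constructor
  -- The sign of r₂ selects 3d; the opposite sign would give d.
  · obtain ⟨h, h4⟩ := hW.exists_half (hW.isTorsionX_two (Or.inl rfl)) (r₁ := 0)
      (r₂ := -(s * (1 - w))) (r₃ := s * (1 + w)) (by ring)
      (by linear_combination (1 - w) ^ 2 * hs + d * hw)
      (by linear_combination (1 + w) ^ 2 * hs + d * hw)
    rw [show (3 * d : AlgebraicClosure ℚ) = 2 * d + 0 * -(s * (1 - w)) + 0 * (s * (1 + w)) +
      -(s * (1 - w)) * (s * (1 + w)) by linear_combination -(w ^ 2 - 1) * hs - d * hw]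
    exact ⟨_, h, h4⟩
  · obtain ⟨h, h4⟩ := hW.exists_half (hW.isTorsionX_two (Or.inr (Or.inr rfl)))
      (r₁ := -(i * (s * (1 + w)))) (r₂ := i * (2 * s * t)) (r₃ := 0)
      (by linear_combination s ^ 2 * (1 + w) ^ 2 * hi - (1 + w) ^ 2 * hs - d * hw)
      (by linear_combination 4 * s ^ 2 * t ^ 2 * hi - 4 * s ^ 2 * ht - 4 * w * hs) (by ring)
    rw [show d * (-1 - 2 * w) + 2 * d * (1 + w) * t = d * (-1 - 2 * w) +
      -(i * (s * (1 + w))) * (i * (2 * s * t)) + -(i * (s * (1 + w))) * 0 +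
      i * (2 * s * t) * 0 by
        linear_combination 2 * s ^ 2 * (1 + w) * t * hi - 2 * (1 + w) * t * hs]
    exact ⟨_, h, h4⟩

-- Halving (2d, 0) yields s(1 - w) and s(1 + w), whose sum is 2s. Halving (e₃, 0) then yields i and
-- t = u².
open Classical in
theorem octicField_sup_le (hd : d ≠ 0) (hζ : ζ ^ 8 = -1) (hu : u ^ 4 = ζ ^ 2 - ζ ^ 6)
    (hs : s ^ 2 = d) : octicField ζ u ⊔ ℚ⟮s⟯ ≤ divisionField (twistCurve d) 4 := by
  obtain ⟨K, hK⟩ : ∃ K, K = divisionField (twistCurve d) 4 := ⟨_, rfl⟩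
  rw [← hK]
  have hw := sqrt_two_sq hζ
  have hi := zeta_pow_four_sq hζ
  have ht : (u ^ 2) ^ 2 = ζ ^ 2 - ζ ^ 6 := by rw [← hu]; ring
  obtain ⟨w, hwe⟩ : ∃ w, w = ζ ^ 2 - ζ ^ 6 := ⟨_, rfl⟩
  obtain ⟨i, hie⟩ : ∃ i, i = ζ ^ 4 := ⟨_, rfl⟩
  obtain ⟨t, hte⟩ : ∃ t, t = u ^ 2 := ⟨_, rfl⟩
  rw [← hwe] at hw ht
  rw [← hie] at hi
  rw [← hte] at ht
  have hW := isSplit_twistCurve hd hw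
  have hs0 := sqrt_ne_zero hd hs
  have hwK : w ∈ K := by
    rw [hK]
    exact divisionField_le_divisionField _ (by norm_num) (sqrt_two_mem_divisionField hd hw)
  have h2 : (2 : AlgebraicClosure ℚ) ∈ K := ofNat_mem _ 2
  have hone : 1 + w ≠ 0 := by
    intro h
    exact one_ne_zero (α := AlgebraicClosure ℚ) (by linear_combination (w - 1) * h - hw)
  obtain ⟨-, h₁, h₃⟩ := sqrt_mem_divisionField hd hw (hW.isTorsionX_two (Or.inl rfl)) (r₁ := 0)
    (r₂ := s * (1 - w)) (r₃ := s * (1 + w)) (by ring)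
    (by linear_combination (1 - w) ^ 2 * hs + d * hw)
    (by linear_combination (1 + w) ^ 2 * hs + d * hw)
  rw [← hK] at h₁ h₃
  have hsK : s ∈ K := by
    rw [show s = (s * (1 - w) + s * (1 + w)) / 2 by ring]
    exact div_mem (add_mem h₁ h₃) h2
  obtain ⟨h₁, h₂, -⟩ := sqrt_mem_divisionField hd hw (hW.isTorsionX_two (Or.inr (Or.inr rfl)))
    (r₁ := i * (s * (1 + w))) (r₂ := i * (2 * s * t)) (r₃ := 0)
    (by linear_combination s ^ 2 * (1 + w) ^ 2 * hi - (1 + w) ^ 2 * hs - d * hw)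
    (by linear_combination 4 * s ^ 2 * t ^ 2 * hi - 4 * s ^ 2 * ht - 4 * w * hs) (by ring)
  rw [← hK] at h₁ h₂
  have hiK : i ∈ K := by
    rw [show i = i * (s * (1 + w)) / (s * (1 + w)) by field_simp]
    exact div_mem h₁ (mul_mem hsK (add_mem (one_mem _) hwK))
  have htK : t ∈ K := by
    rw [show t = -(i * (i * (2 * s * t)) / (2 * s)) by field_simp; linear_combination t * hi]
    exact neg_mem (div_mem (mul_mem hiK h₂) (mul_mem h2 hsK))
  refine sup_le (octicField_le_of_mem (zeta_sq_mem_of_sqrt_two_mem hζ ?_ ?_) ?_)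
    (adjoin_simple_le_iff.2 hsK)
  exacts [hie ▸ hiK, hwe ▸ hwK, hte ▸ htK]

open Classical in
theorem divisionField_four (hd : d ≠ 0) (hζ : ζ ^ 8 = -1) (hu : u ^ 4 = ζ ^ 2 - ζ ^ 6)
    (hs : s ^ 2 = d) : divisionField (twistCurve d) 4 = octicField ζ u ⊔ ℚ⟮s⟯ := by
  refine le_antisymm (divisionField_le _ fun x y h h4 => ?_) (octicField_sup_le hd hζ hu hs)
  have hW := isSplit_twistCurve hd (sqrt_two_sq hζ)
  have hzK : ζ ^ 2 ∈ octicField ζ u ⊔ ℚ⟮s⟯ := mem_of_le_sup_left (zeta_sq_mem_octicField ζ u)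
  have hiK : ζ ^ 4 ∈ octicField ζ u ⊔ ℚ⟮s⟯ := by
    rw [show ζ ^ 4 = (ζ ^ 2) ^ 2 by ring]
    exact pow_mem hzK 2
  have htK : u ^ 2 ∈ octicField ζ u ⊔ ℚ⟮s⟯ := mem_of_le_sup_left (u_sq_mem_octicField ζ u)
  have ht : (u ^ 2) ^ 2 = ζ ^ 2 - ζ ^ 6 := by rw [← hu]; ring
  have hwK : ζ ^ 2 - ζ ^ 6 ∈ octicField ζ u ⊔ ℚ⟮s⟯ := ht ▸ pow_mem htK 2
  obtain ⟨h₁, h₂, h₃⟩ := two_torsion_mem (d := d) hwK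
  refine hW.mem_of_two_mul_nsmul_eq_zero h₁ h₂ h₃ (n := 2) (fun X hX r hr => ?_) h h4
  exact sqrt_two_torsion_sub_mem (zeta_pow_four_sq hζ) ht (sqrt_two_sq hζ) hs hiK htK
    (self_mem_sup_adjoin _ s) (hW.eq_of_isTorsionX_two hX) hr

/-- Explicit square roots of the differences between the first coordinate of a point killed by `4`
and the first coordinates of the points killed by `2`. -/
theorem sq_sqrt_four_torsion_sub {L : Type*} [Field L] {d s i w t μ η : L} (hi : i ^ 2 = -1)
    (hw : w ^ 2 = 2) (ht : t ^ 2 = w) (hμ : μ ^ 2 = t) (hη : η ^ 2 = 1 + w) (hs : s ^ 2 = d) :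
    (i * s * η * (1 - t)) ^ 2 = d * (-1 - 2 * w) + 2 * d * (1 + w) * t - 2 * d ∧
    (s * w * μ * (1 - t)) ^ 2 =
      d * (-1 - 2 * w) + 2 * d * (1 + w) * t - d * (-1 + 2 * w) ∧
    (s * w * μ * η) ^ 2 = d * (-1 - 2 * w) + 2 * d * (1 + w) * t - d * (-1 - 2 * w) := by
  refine ⟨?_, ?_, ?_⟩
  · linear_combination (s * η * (1 - t)) ^ 2 * hi - η ^ 2 * (1 - t) ^ 2 * hs
      - d * (1 - t) ^ 2 * hη - d * (1 + w) * ht - d * hw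
  · linear_combination (w * μ * (1 - t)) ^ 2 * hs + d * (μ * (1 - t)) ^ 2 * hw
      + 2 * d * (1 - t) ^ 2 * hμ + (2 * d * t - 4 * d) * ht
  · linear_combination (w * μ * η) ^ 2 * hs + d * (μ * η) ^ 2 * hw + 2 * d * η ^ 2 * hμ
      + 2 * d * t * hη

/-- Since 2 + √2 = √2(1 + √2), a square root of 1 + √2 costs only ζ + ζ⁻¹ and 2^(1/4). -/
theorem div_sq_eq_one_add {L : Type*} [Field L] {w t c : L} (hw : w ^ 2 = 2) (ht : t ^ 2 = w)
    (ht0 : t ≠ 0) (hc : c ^ 2 = w + 2) : (c / t) ^ 2 = 1 + w := by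
  field_simp
  linear_combination hc - hw - (1 + w) * ht

-- Halving the point over 3d gives c = ζ + ζ⁻¹ and c' = ζ - ζ⁻¹, hence ζ. Halving the other point of
-- `isTorsionX_four` gives u.
open Classical in
theorem kummerEight_sup_le (hd : d ≠ 0) (hζ : ζ ^ 8 = -1) (hu : u ^ 4 = ζ ^ 2 - ζ ^ 6)
    (hs : s ^ 2 = d) : kummerEight ζ u ⊔ ℚ⟮s⟯ ≤ divisionField (twistCurve d) 8 := by
  have hw := sqrt_two_sq hζ
  have hi := zeta_pow_four_sq hζ
  have ht : (u ^ 2) ^ 2 = ζ ^ 2 - ζ ^ 6 := by rw [← hu]; ring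
  have hc : (ζ - ζ ^ 7) ^ 2 = ζ ^ 2 - ζ ^ 6 + 2 := by linear_combination (ζ ^ 6 - 2) * hζ
  have hc' : (ζ + ζ ^ 7) ^ 2 = ζ ^ 2 - ζ ^ 6 - 2 := by linear_combination (ζ ^ 6 + 2) * hζ
  have h48 := (octicField_sup_le hd hζ hu hs).trans
    (divisionField_le_divisionField (twistCurve d) (by norm_num : 4 ∣ 8))
  obtain ⟨K, hK⟩ : ∃ K, K = divisionField (twistCurve d) 8 := ⟨_, rfl⟩
  rw [← hK] at h48 ⊢
  have hsK : s ∈ K := h48 (self_mem_sup_adjoin _ s)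
  have hzK : ζ ^ 2 ∈ K := h48 (mem_of_le_sup_left (zeta_sq_mem_octicField ζ u))
  have htK : u ^ 2 ∈ K := h48 (mem_of_le_sup_left (u_sq_mem_octicField ζ u))
  have hiK : ζ ^ 4 ∈ K := by
    rw [show ζ ^ 4 = (ζ ^ 2) ^ 2 by ring]
    exact pow_mem hzK 2
  have hs0 := sqrt_ne_zero hd hs
  have hζ0 := zeta_ne_zero hζ
  obtain ⟨w, hwe⟩ : ∃ w, w = ζ ^ 2 - ζ ^ 6 := ⟨_, rfl⟩
  obtain ⟨i, hie⟩ : ∃ i, i = ζ ^ 4 := ⟨_, rfl⟩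
  obtain ⟨t, hte⟩ : ∃ t, t = u ^ 2 := ⟨_, rfl⟩
  obtain ⟨c, hce⟩ : ∃ c, c = ζ - ζ ^ 7 := ⟨_, rfl⟩
  obtain ⟨c', hce'⟩ : ∃ c', c' = ζ + ζ ^ 7 := ⟨_, rfl⟩
  rw [← hwe] at hw ht hc hc'
  rw [← hie] at hi hiK
  rw [← hte] at ht htK
  rw [← hce] at hc
  rw [← hce'] at hc'
  have hi0 : i ≠ 0 := by rw [hie]; exact pow_ne_zero 4 hζ0
  have hwK : w ∈ K := ht ▸ pow_mem htK 2
  have hw0 : w ≠ 0 := by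
    rintro rfl
    norm_num at hw
  have ht0 : t ≠ 0 := by
    rintro rfl
    exact hw0 (by rw [← ht]; ring)
  have ht1 : 1 - t ≠ 0 := by
    intro h
    exact one_ne_zero (α := AlgebraicClosure ℚ)
      (by linear_combination -(1 + t) * (1 + t ^ 2) * h - hw - (t ^ 2 + w) * ht)
  have h2 : (2 : AlgebraicClosure ℚ) ∈ K := ofNat_mem _ 2
  obtain ⟨hX, hX'⟩ := isTorsionX_four hd hi ht hw hs
  obtain ⟨-, h₂, h₃⟩ := sqrt_mem_divisionField hd hw hX (r₁ := s) (r₂ := s * w * i * c')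
    (r₃ := s * w * c) (by linear_combination hs)
    (by linear_combination (w * i * c') ^ 2 * hs + d * (i * c') ^ 2 * hw
      + 2 * d * c' ^ 2 * hi - 2 * d * hc')
    (by linear_combination (w * c) ^ 2 * hs + d * c ^ 2 * hw + 2 * d * hc)
  rw [← hK] at h₂ h₃
  have hcK : c ∈ K := by
    rw [show c = s * w * c / (s * w) by field_simp]
    exact div_mem h₃ (mul_mem hsK hwK)
  have hcK' : c' ∈ K := by
    rw [show c' = s * w * i * c' / (s * w * i) by field_simp]
    exact div_mem h₂ (mul_mem (mul_mem hsK hwK) hiK)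
  obtain ⟨e1, e2, e3⟩ :=
    sq_sqrt_four_torsion_sub hi hw ht hte.symm (div_sq_eq_one_add hw ht ht0 hc) hs
  obtain ⟨-, h₂, -⟩ := sqrt_mem_divisionField hd hw hX' e1 e2 e3
  rw [← hK] at h₂
  have huK : u ∈ K := by
    rw [show u = s * w * u * (1 - t) / (s * w * (1 - t)) by field_simp]
    exact div_mem h₂ (mul_mem (mul_mem hsK hwK) (sub_mem (one_mem _) htK))
  have hζK : ζ ∈ K := by
    rw [show ζ = (c + c') / 2 by rw [hce, hce']; ring]
    exact div_mem (add_mem hcK hcK') h2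
  exact sup_le (kummerEight_le_of_mem hζK huK) (adjoin_simple_le_iff.2 hsK)

theorem sqrt_four_torsion_sub_mem {L : Type*} [Field L] [CharZero L] {K : IntermediateField ℚ L}
    {d s i w t μ η : L} (hi : i ^ 2 = -1)
    (hw : w ^ 2 = 2) (ht : t ^ 2 = w) (hμ : μ ^ 2 = t) (hη : η ^ 2 = 1 + w) (hs : s ^ 2 = d)
    (hiK : i ∈ K) (hμK : μ ∈ K) (hηK : η ∈ K) (hsK : s ∈ K) {X r : L}
    (hX : X = d * (-1 - 2 * w) + 2 * d * (1 + w) * t)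
    (hr : r ^ 2 = X - 2 * d ∨ r ^ 2 = X - d * (-1 + 2 * w) ∨ r ^ 2 = X - d * (-1 - 2 * w)) :
    r ∈ K := by
  obtain ⟨e1, e2, e3⟩ := sq_sqrt_four_torsion_sub hi hw ht hμ hη hs
  have htK : t ∈ K := hμ ▸ pow_mem hμK 2
  have hwK : w ∈ K := ht ▸ pow_mem htK 2
  have h1t := sub_mem (one_mem K) htK
  have h1 := mul_mem (mul_mem hsK hwK) hμK
  rw [hX, ← e1, ← e2, ← e3] at hr
  rcases hr with hr | hr | hr
  · exact mem_of_sq_eq_sq (mul_mem (mul_mem (mul_mem hiK hsK) hηK) h1t) hr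
  · exact mem_of_sq_eq_sq (mul_mem h1 h1t) hr
  · exact mem_of_sq_eq_sq (mul_mem h1 hηK) hr

open Classical in
theorem divisionField_eight (hd : d ≠ 0) (hζ : ζ ^ 8 = -1) (hu : u ^ 4 = ζ ^ 2 - ζ ^ 6)
    (hs : s ^ 2 = d) : divisionField (twistCurve d) 8 = kummerEight ζ u ⊔ ℚ⟮s⟯ := by
  refine le_antisymm (divisionField_le _ fun x y h h8 => ?_) (kummerEight_sup_le hd hζ hu hs)
  have hζK : ζ ∈ kummerEight ζ u ⊔ ℚ⟮s⟯ := mem_of_le_sup_left (zeta_mem_kummerEight ζ u)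
  have huK : u ∈ kummerEight ζ u ⊔ ℚ⟮s⟯ := mem_of_le_sup_left (u_mem_kummerEight ζ u)
  have hsK : s ∈ kummerEight ζ u ⊔ ℚ⟮s⟯ := self_mem_sup_adjoin _ s
  obtain ⟨K, hK⟩ : ∃ K, K = kummerEight ζ u ⊔ ℚ⟮s⟯ := ⟨_, rfl⟩
  rw [← hK] at hζK huK hsK ⊢
  have hw := sqrt_two_sq hζ
  have hi := zeta_pow_four_sq hζ
  have ht : (u ^ 2) ^ 2 = ζ ^ 2 - ζ ^ 6 := by rw [← hu]; ring
  have hc : (ζ - ζ ^ 7) ^ 2 = ζ ^ 2 - ζ ^ 6 + 2 := by linear_combination (ζ ^ 6 - 2) * hζ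
  have hc' : (ζ + ζ ^ 7) ^ 2 = ζ ^ 2 - ζ ^ 6 - 2 := by linear_combination (ζ ^ 6 + 2) * hζ
  have hiK := pow_mem hζK 4
  have htK := pow_mem huK 2
  have hcK := sub_mem hζK (pow_mem hζK 7)
  have hcK' := add_mem hζK (pow_mem hζK 7)
  have hzz : (ζ ^ 2) ^ 2 = ζ ^ 4 := by ring
  have hzK := pow_mem hζK 2
  have ht0 := pow_ne_zero 2 (u_ne_zero hζ hu)
  obtain ⟨w, hwe⟩ : ∃ w, w = ζ ^ 2 - ζ ^ 6 := ⟨_, rfl⟩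
  obtain ⟨i, hie⟩ : ∃ i, i = ζ ^ 4 := ⟨_, rfl⟩
  obtain ⟨z, hze⟩ : ∃ z, z = ζ ^ 2 := ⟨_, rfl⟩
  obtain ⟨t, hte⟩ : ∃ t, t = u ^ 2 := ⟨_, rfl⟩
  obtain ⟨c, hce⟩ : ∃ c, c = ζ - ζ ^ 7 := ⟨_, rfl⟩
  obtain ⟨c', hce'⟩ : ∃ c', c' = ζ + ζ ^ 7 := ⟨_, rfl⟩
  rw [← hwe] at hw ht hc hc'
  rw [← hie] at hi hiK hzz
  rw [← hte] at ht htK ht0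
  rw [← hce] at hc hcK
  rw [← hce'] at hc' hcK'
  rw [← hze] at hzz hzK
  have hwK : w ∈ K := ht ▸ pow_mem htK 2
  have hW := isSplit_twistCurve hd hw
  obtain ⟨h₁, h₂, h₃⟩ := two_torsion_mem (d := d) hwK
  have hη := div_sq_eq_one_add hw ht ht0 hc
  -- The conjugate of the root of 1 + √2: c'² = √2 - 2 = √2(1 - √2).
  have hη' : (c' / t) ^ 2 = 1 + -w := by
    field_simp
    linear_combination hc' + hw - (1 - w) * ht
  have hw' : (-w) ^ 2 = 2 := by rw [neg_sq, hw]
  have hηK := div_mem hcK htK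
  have hηK' := div_mem hcK' htK
  refine hW.mem_of_two_mul_nsmul_eq_zero h₁ h₂ h₃ (n := 4) (fun X hX r hr => ?_) h h8
  rcases hW.eq_of_isTorsionX_four hX with hX | hX | hX | hX
  · exact sqrt_two_torsion_sub_mem hi ht hw hs hiK htK hsK hX hr
  · rcases sq_eq_sq_iff_eq_or_eq_neg.1 (show (X - 2 * d) ^ 2 = (d : AlgebraicClosure ℚ) ^ 2 by
        linear_combination hX - 4 * (d : AlgebraicClosure ℚ) ^ 2 * hw) with hX | hX
    · have hX3 : X = 3 * d := by linear_combination hX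
      subst hX3
      rcases hr with hr | hr | hr
      · exact mem_of_sq_eq_sq hsK (by linear_combination hr - hs)
      · exact mem_of_sq_eq_sq (a := s * w * i * c')
          (mul_mem (mul_mem (mul_mem hsK hwK) hiK) hcK')
          (by linear_combination hr - ((w * i * c') ^ 2 * hs + d * (i * c') ^ 2 * hw
            + 2 * d * c' ^ 2 * hi - 2 * d * hc'))
      · exact mem_of_sq_eq_sq (a := s * w * c) (mul_mem (mul_mem hsK hwK) hcK)
          (by linear_combination hr - ((w * c) ^ 2 * hs + d * c ^ 2 * hw + 2 * d * hc))
    · have hX1 : X = d := by linear_combination hX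
      subst hX1
      rcases hr with hr | hr | hr
      · exact mem_of_sq_eq_sq (a := i * s) (mul_mem hiK hsK)
          (by linear_combination hr - s ^ 2 * hi + hs)
      · exact mem_of_sq_eq_sq (a := s * t * c') (mul_mem (mul_mem hsK htK) hcK')
          (by linear_combination hr - ((t * c') ^ 2 * hs + d * c' ^ 2 * ht + d * w * hc'
            + d * hw))
      · exact mem_of_sq_eq_sq (a := s * t * c) (mul_mem (mul_mem hsK htK) hcK)
          (by linear_combination hr - ((t * c) ^ 2 * hs + d * c ^ 2 * ht + d * w * hc
            + d * hw))
  -- Replacing w by -w exchanges e₂ and e₃, which reduces this case to the one over e₃. The role of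
  -- t passes to ±it, whose square roots are zu and izu because z² = i.
  · have hr' : r ^ 2 = X - 2 * d ∨ r ^ 2 = X - d * (-1 + 2 * -w) ∨
        r ^ 2 = X - d * (-1 - 2 * -w) := by
      rcases hr with hr | hr | hr
      · exact Or.inl hr
      · exact Or.inr (Or.inr (by rw [hr]; ring))
      · exact Or.inr (Or.inl (by rw [hr]; ring))
    rcases sq_eq_sq_iff_eq_or_eq_neg.1
        (show (X - d * (-1 + 2 * w)) ^ 2 = (2 * d * (1 - w) * (i * t)) ^ 2 by
          linear_combination hX - 4 * (d : AlgebraicClosure ℚ) ^ 2 * (1 - w) ^ 2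
            * (t ^ 2 * hi - ht) + 4 * (d : AlgebraicClosure ℚ) ^ 2 * w * hw) with hX | hX
    · exact sqrt_four_torsion_sub_mem hi hw' (t := i * t) (μ := z * u)
        (by linear_combination t ^ 2 * hi - ht) (by rw [hte, ← hzz]; ring) hη' hs hiK
        (mul_mem hzK huK) hηK' hsK (by linear_combination hX) hr'
    · exact sqrt_four_torsion_sub_mem hi hw' (t := -(i * t)) (μ := i * (z * u))
        (by linear_combination t ^ 2 * hi - ht)
        (by rw [hte]; linear_combination (z * u) ^ 2 * hi - u ^ 2 * hzz) hη' hs hiK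
        (mul_mem hiK (mul_mem hzK huK)) hηK' hsK (by linear_combination hX) hr'
  · rcases sq_eq_sq_iff_eq_or_eq_neg.1
        (show (X - d * (-1 - 2 * w)) ^ 2 = (2 * d * (1 + w) * t) ^ 2 by
          linear_combination hX - 4 * (d : AlgebraicClosure ℚ) ^ 2 * (1 + w) ^ 2 * ht
            - 4 * (d : AlgebraicClosure ℚ) ^ 2 * w * hw) with hX | hX
    · exact sqrt_four_torsion_sub_mem hi hw ht hte.symm hη hs hiK huK hηK hsK
        (by linear_combination hX) hr
    · exact sqrt_four_torsion_sub_mem hi hw (t := -t) (μ := i * u) (by rw [neg_sq, ht])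
        (by rw [hte]; linear_combination u ^ 2 * hi) hη hs hiK
        (mul_mem hiK huK) hηK hsK (by linear_combination hX) hr

end DivisionFields

/-! ### The effect of √d on the degrees. -/

section Degrees

open IntermediateField

theorem finrank_adjoin_sqrt_two {L : Type*} [Field L] [CharZero L] {w : L} (hw : w ^ 2 = 2) :
    Module.finrank ℚ ℚ⟮w⟯ = 2 := by
  have hmem : w ∉ (⊥ : IntermediateField ℚ L) := by
    intro h
    obtain ⟨a, rfl⟩ := exists_ratCast_of_mem_bot h
    have ha : a ^ 2 = 2 := by exact_mod_cast hw
    exact one_ne_zero (eq_zero_of_sq_eq_two_mul_sq (a := a) (b := 1) (by rw [ha]; norm_num))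
  have := finrank_sup_adjoin_sqrt (K := (⊥ : IntermediateField ℚ L)) (r := w)
    (by rw [hw]; exact ofNat_mem _ 2) hmem
  rwa [bot_sup_eq, IntermediateField.finrank_bot] at this

/-- One sandwich serves both levels: the smallest admissible K already contains √d for the
exceptional d, and the largest contains it for no other squarefree d. -/
theorem finrank_sup_adjoin_sqrt_squarefree {L : Type*} [Field L] [CharZero L] {ζ u s : L}
    (hζ : ζ ^ 8 = -1) (hu : u ^ 4 = ζ ^ 2 - ζ ^ 6) {d : ℤ} (hd : Squarefree d) (hs : s ^ 2 = d)
    {K : IntermediateField ℚ L} (hK : octicField ζ u ≤ K) (hK' : K ≤ kummerEight ζ u) :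
    (d ∈ ({1, -1, 2, -2} : Set ℤ) →
      Module.finrank ℚ (K ⊔ ℚ⟮s⟯ : IntermediateField ℚ L) = Module.finrank ℚ K) ∧
    (d ∉ ({1, -1, 2, -2} : Set ℤ) →
      Module.finrank ℚ (K ⊔ ℚ⟮s⟯ : IntermediateField ℚ L) = 2 * Module.finrank ℚ K) := by
  constructor
  · intro h
    rw [sup_eq_left.2 (adjoin_simple_le_iff.2
      (hK (mem_octicField_of_mem_pm_one_pm_two hζ h hs)))]
  · intro h
    have := finiteDimensional_of_finrank_ne_zero
      ((finrank_kummerEight hζ hu).trans_ne (by norm_num))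
    have : FiniteDimensional ℚ K := Module.Finite.of_injective
      (IntermediateField.inclusion hK').toLinearMap (IntermediateField.inclusion hK').injective
    refine finrank_sup_adjoin_sqrt (by rw [hs]; exact intCast_mem K d) fun hsK => ?_
    exact h (mem_pm_one_pm_two_of_mem_kummerEight hζ hu hd hs (hK' hsK))

theorem adjoin_pair_eq_sup {F L : Type*} [Field F] [Field L] [Algebra F L] (a b : L) :
    adjoin F {a, b} = F⟮a⟯ ⊔ F⟮b⟯ := by
  rw [Set.insert_eq, adjoin_union]

end Degrees

theorem mainTheorem8 (d : ℤ) (hd : Squarefree d) :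
    -- the `2`-division field is `ℚ(√2)`
    (∀ r : AlgebraicClosure ℚ, r ^ 2 = 2 →
      divisionField (twistCurve d) 2 = IntermediateField.adjoin ℚ {r}) ∧
    -- the `4`-division field is `ℚ(α, √d)`, with `ℚ(α)` of degree `8`
    (∀ α : AlgebraicClosure ℚ, aeval α polyFour = 0 →
      Module.finrank ℚ (IntermediateField.adjoin ℚ {α}) = 8 ∧
      ∀ s : AlgebraicClosure ℚ, s ^ 2 = (d : AlgebraicClosure ℚ) →
        divisionField (twistCurve d) 4 = IntermediateField.adjoin ℚ {α, s}) ∧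
    -- the `8`-division field is `ℚ(β, √d)`, with `ℚ(β)` of degree `32`
    (∀ β : AlgebraicClosure ℚ, aeval β polyEight = 0 →
      Module.finrank ℚ (IntermediateField.adjoin ℚ {β}) = 32 ∧
      ∀ s : AlgebraicClosure ℚ, s ^ 2 = (d : AlgebraicClosure ℚ) →
        divisionField (twistCurve d) 8 = IntermediateField.adjoin ℚ {β, s}) ∧
    -- the degrees
    Module.finrank ℚ (divisionField (twistCurve d) 2) = 2 ∧
    (Module.finrank ℚ (divisionField (twistCurve d) 4) = 8 ↔ d ∈ ({1, -1, 2, -2} : Set ℤ)) ∧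
    (Module.finrank ℚ (divisionField (twistCurve d) 8) = 32 ↔ d ∈ ({1, -1, 2, -2} : Set ℤ)) ∧
    (d ∉ ({1, -1, 2, -2} : Set ℤ) →
      Module.finrank ℚ (divisionField (twistCurve d) 4) = 16 ∧
      Module.finrank ℚ (divisionField (twistCurve d) 8) = 64) := by
  obtain ⟨ζ, hζ⟩ := IsAlgClosed.exists_pow_nat_eq (-1 : AlgebraicClosure ℚ) (n := 8) (by norm_num)
  obtain ⟨u, hu⟩ := IsAlgClosed.exists_pow_nat_eq (ζ ^ 2 - ζ ^ 6) (n := 4) (by norm_num)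
  obtain ⟨s, hs⟩ := IsAlgClosed.exists_pow_nat_eq (d : AlgebraicClosure ℚ) (n := 2) (by norm_num)
  have hd0 := hd.ne_zero
  have h4 := finrank_octicField hζ hu
  have h8 := finrank_kummerEight hζ hu
  have hD4 := finrank_sup_adjoin_sqrt_squarefree hζ hu hd hs le_rfl (octicField_le ζ u)
  have hD8 := finrank_sup_adjoin_sqrt_squarefree hζ hu hd hs (octicField_le ζ u) le_rfl
  rw [← divisionField_four hd0 hζ hu hs, h4] at hD4
  rw [← divisionField_eight hd0 hζ hu hs, h8] at hD8
  refine ⟨fun r hr => divisionField_two hd0 hr, fun α hα => ?_, fun β hβ => ?_, ?_,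
    ⟨fun h => ?_, hD4.1⟩, ⟨fun h => ?_, hD8.1⟩, fun h => ⟨hD4.2 h, hD8.2 h⟩⟩
  · have hα' := octicField_eq_adjoin hζ hu hα
    refine ⟨by rw [← hα', h4], fun s hs => ?_⟩
    rw [adjoin_pair_eq_sup, ← hα', divisionField_four hd0 hζ hu hs]
  · have : IsGalois ℚ (AlgebraicClosure ℚ) :=
      @IsAlgClosure.isGalois ℚ (AlgebraicClosure ℚ) _ _ (AlgebraicClosure.instAlgebra ℚ) _ _
    have hβ' := kummerEight_eq_adjoin hζ hu hβ
    refine ⟨by rw [← hβ', h8], fun s hs => ?_⟩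
    rw [adjoin_pair_eq_sup, ← hβ', divisionField_eight hd0 hζ hu hs]
  · rw [divisionField_two hd0 (sqrt_two_sq hζ)]
    exact finrank_adjoin_sqrt_two (sqrt_two_sq hζ)
  · by_contra hn
    have := hD4.2 hn
    omega
  · by_contra hn
    have := hD8.2 hn
    omega
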